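/- **Setting.** Let $d,m\in\mathbb N$, $T>0$, $k\in\mathbb N$ with $k>\frac d2$, and $\rho\ge 1$. *Hölder spaces.* For a Banach space $E$, $C_2^\zeta([0,T];E)$ is the set of continuous $g:\{0\le s<t\le T\}\to E$ with $[g]_\zeta:=\sup_{s<t}\|g_{st}\|/|t-s|^\zeta<\infty$, and $C^\zeta([0,T];E)$ is the set of paths $f$ whose increments $f_{st}:=f_t-f_s$ lie in $C_2^\zeta$. $C^\alpha_0([0,T];\mathbb R^d)\subset C^\alpha([0,T];\mathbb R^d)$ is the set of paths with $\lim_{h\to0}\sup_{0<t-s\le h}|f_{st}|/|t-s|^\alpha=0$. *Rough paths.* $E\otimes E$ denotes the completed projective tensor product. $\mathscr C^\alpha([0,T];E)$ is the set of pairs $\mathbf X=(X,\mathbb X)\in C^\alpha([0,T];E)\times C^{2\alpha}_2([0,T];E\otimes E)$ with $\mathbb X_{st}-\mathbb X_{ut}-\mathbb X_{su}=X_{su}\otimes X_{ut}$ for $s<u<t$, with the distance $[X-Y]_\alpha+[\mathbb X-\mathbb Y]_{2\alpha}$. $\mathbf X$ is weakly geometric ($\mathbf X\in\mathscr C^\alpha_{wg}$)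 if $\mathrm{sym}(\mathbb X_{st})=\frac12X_{st}\otimes X_{st}$. The set $\mathscr C^\alpha_g([0,T];E)$ of geometric rough paths is the closure in $\mathscr C^\alpha([0,T];E)$ of the set of those canonical lifts $(x,\int_s^t x_{sr}\otimes dx_r)$ of paths $x$ of bounded variation that belong to $\mathscr C^\alpha([0,T];E)$. *Controlled paths.* For $Z:[0,T]\to\mathbb R^m$, $\mathscr D^{2\alpha}_Z([0,T];E)$ is the set of pairs $(Y,Y')$ with $Y:[0,T]\to E$, $Y'\in C^\alpha([0,T];\mathcal L(\mathbb R^m;E))$ and $(s,t)\mapsto Y_t-Y_s-Y'_sZ_{st}$ in $C_2^{2\alpha}([0,T];E)$. *Function spaces.* $H^k=W^{k,2}(\mathbb R^d;\mathbb R^d)$ with $\|u\|_{H^k}^2=\sum_{|\beta|\le k}\|D^\beta u\|_{L^2}^2$. $C^3_b\otimes H^k$ is the space of continuous $f:\mathbb R^d\times\mathbb R^d\to\mathbb R^d$ with $f(x,\cdot)\in H^k$ for all $x$, $f(\cdot,y)\in C^3_b$ for all $y$, and $\sum_{i\le3,|\beta|\le k}\sup_x\int|\nabla_1^iD_2^\beta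 f(x,y)|^2dy<\infty$ (Fréchet derivatives in the first variable, weak derivatives in the second). *Controlled measures.* $\mathcal M^{2\alpha,\rho}_Z$ is the set of pairs $(\mu,\gamma)$ where $\mu$ is a Borel probability measure on $C^\alpha_0([0,T];\mathbb R^d)$ with $\int[\omega]_\alpha^\rho\,d\mu(\omega)<\infty$, $\gamma\in C^\alpha([0,T];\mathcal L(\mathbb R^m;C_b^3(\mathbb R^d;\mathbb R^d)))$, and for every $\phi\in C_b^3\otimes H^k$ one has $(\mu(\phi),\mu(\nabla_1\phi\,\gamma))\in\mathscr D^{2\alpha}_Z([0,T];H^k)$, where $$\mu(\phi)_t=\int\phi(\omega_t,\cdot)\,d\mu(\omega),\qquad \mu(\nabla_1\phi\,\gamma)^j_t=\int\nabla_1\phi(\omega_t,\cdot)\gamma^j_t(\omega_t)\,d\mu(\omega),\quad j=1,\dots,m.$$ **Proposition.** Let $\bar\alpha\in(\frac13,\frac12)$, $\alpha\in(\frac13,\bar\alpha)$, let $\mathbf Z=(Z,\mathbb Z)\in\mathscr C^{\bar\alpha}_{wg}([0,T];\mathbb R^m)$ be weakly geometric, $(\mu,\gamma)\in\mathcal M^{2\alpha,\rho}_Z$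 and $\phi=(\phi^1,\dots,\phi^m)$ with $\phi^i\in C^3_b\otimes H^k$ (that is, $\phi\in\mathcal L(\mathbb R^m;C_b^3\otimes H^k)$). Write $Y^i=\mu(\phi^i)$ and $Y^{i,l}=\mu(\nabla_1\phi^i\,\gamma)^l$. Then the rough integrals $$X_t=\int_0^tY_r\,d\mathbf Z_r\in H^k,\qquad \mathbb X_{st}=\int_s^tX_r\otimes Y_r\,d\mathbf Z_r-X_s\otimes X_{st}\in H^k\otimes H^k,$$ defined as limits, as the mesh of the partitions tends to $0$, of the Riemann sums of the local expansions (summation over repeated indices) $$Y^i_sZ^i_{st}+Y^{i,l}_s\mathbb Z^{l,i}_{st},\qquad X_s\otimes Y^i_sZ^i_{st}+\big(Y^l_s\otimes Y^i_s+X_s\otimes Y^{i,l}_s\big)\mathbb Z^{l,i}_{st},$$ exist, and $\mathbf X^\phi=(X,\mathbb X)$ is a geometric rough path: $\mathbf X^\phi\in\mathscr C^\alpha_g([0,T];H^k)$. -/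

import Mathlib

open MeasureTheory Set Filter Topology
open scoped ENNReal

noncomputable section

namespace RoughMV

/-- `ℝ^d` with its Euclidean norm. -/
abbrev Rd (d : ℕ) : Type := EuclideanSpace ℝ (Fin d)

/-- The time interval `[0,T]`. -/
abbrev I (T : ℝ) : Type := Set.Icc (0 : ℝ) T

/-! ### Hoelder spaces -/

section Hoelder

variable {T : ℝ} {E : Type*} [NormedAddCommGroup E]

/-- The increment `δf_{st} = f_t - f_s` of a path. -/
def incr (f : I T → E) (s t : I T) : E := f t - f s

/-- `[g]_{ζ,h} = sup { ‖g_{st}‖ / |t-s|^ζ : s < t, t - s ≤ h }`, with values in `[0,∞]`. -/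
def hoelderLoc (ζ h : ℝ) (g : I T → I T → E) : ℝ≥0∞ :=
  ⨆ (s : I T) (t : I T) (_ : s < t) (_ : (t : ℝ) - s ≤ h),
    ‖g s t‖ₑ / ENNReal.ofReal (((t : ℝ) - s) ^ ζ)

/-- `[g]_ζ = [g]_{ζ,T}`. -/
def hoelder (ζ : ℝ) (g : I T → I T → E) : ℝ≥0∞ := hoelderLoc ζ T g

/-- `g ∈ C_2^ζ([0,T];E)`: continuous on the open simplex `s < t`, with `[g]_ζ < ∞`. -/
def MemC2 (ζ : ℝ) (g : I T → I T → E) : Prop :=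
  ContinuousOn (Function.uncurry g) {p | p.1 < p.2} ∧ hoelder ζ g < ∞

/-- `f ∈ C^ζ([0,T];E)`. -/
def MemC (ζ : ℝ) (f : I T → E) : Prop := MemC2 ζ (incr f)

theorem hoelderLoc_zero (ζ h : ℝ) : hoelderLoc ζ h (0 : I T → I T → E) = 0 := by
  simp [hoelderLoc]

theorem hoelderLoc_neg (ζ h : ℝ) (g : I T → I T → E) :
    hoelderLoc ζ h (-g) = hoelderLoc ζ h g := by
  simp [hoelderLoc]

theorem hoelderLoc_add_le (ζ h : ℝ) (f g : I T → I T → E) :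
    hoelderLoc ζ h (f + g) ≤ hoelderLoc ζ h f + hoelderLoc ζ h g := by
  refine iSup_le fun s => iSup_le fun t => iSup_le fun hst => iSup_le fun hh => ?_
  have hf : ‖f s t‖ₑ / ENNReal.ofReal (((t : ℝ) - s) ^ ζ) ≤ hoelderLoc ζ h f :=
    le_iSup_of_le s (le_iSup_of_le t (le_iSup_of_le hst (le_iSup_of_le hh le_rfl)))
  have hg : ‖g s t‖ₑ / ENNReal.ofReal (((t : ℝ) - s) ^ ζ) ≤ hoelderLoc ζ h g :=
    le_iSup_of_le s (le_iSup_of_le t (le_iSup_of_le hst (le_iSup_of_le hh le_rfl)))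
  calc ‖(f + g) s t‖ₑ / ENNReal.ofReal (((t : ℝ) - s) ^ ζ)
      ≤ (‖f s t‖ₑ + ‖g s t‖ₑ) / ENNReal.ofReal (((t : ℝ) - s) ^ ζ) := by
        gcongr
        exact enorm_add_le _ _
    _ ≤ _ := by
        rw [ENNReal.add_div]
        exact add_le_add hf hg

end Hoelder

/-! ### The path space `C_0^α([0,T];ℝ^d)` -/

/-- The space `C_0^α([0,T];ℝ^d)` of `α`-Hoelder paths with `[ω]_{α,h} → 0` as `h → 0`. -/
structure C0Path (α T : ℝ) (d : ℕ) where
  toFun : I T → Rd d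
  mem : MemC α toFun
  small : Tendsto (fun h : ℝ => hoelderLoc α h (incr toFun)) (𝓝[>] 0) (𝓝 0)

namespace C0Path

variable {α T : ℝ} {d : ℕ}

instance : CoeFun (C0Path α T d) (fun _ => I T → Rd d) := ⟨toFun⟩

/-- The Hoelder distance `sup_t |ω_t - ω'_t| + [ω - ω']_α`. -/
instance : PseudoEMetricSpace (C0Path α T d) where
  edist ω η := (⨆ t : I T, ‖ω t - η t‖ₑ) + hoelder α (incr fun t => ω t - η t)
  edist_self ω := by
    have h : incr (fun t => ω t - ω t) = (0 : I T → I T → Rd d) := by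
      funext s t; simp [incr]
    simp only [h, hoelder, hoelderLoc_zero]
    simp
  edist_comm ω η := by
    have h : incr (fun t => ω t - η t) = -incr (fun t => η t - ω t) := by
      funext s t; simp [incr]; abel
    simp only [h, hoelder, hoelderLoc_neg]
    congr 1
    exact iSup_congr fun t => enorm_sub_rev _ _
  edist_triangle ω η θ := by
    have h : incr (fun t => ω t - θ t)
        = incr (fun t => ω t - η t) + incr (fun t => η t - θ t) := by
      funext s t; simp [incr]; abel
    have h1 : (⨆ t : I T, ‖ω t - θ t‖ₑ)
        ≤ (⨆ t : I T, ‖ω t - η t‖ₑ) + ⨆ t : I T, ‖η t - θ t‖ₑ := by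
      refine iSup_le fun t => ?_
      have e : ω t - θ t = (ω t - η t) + (η t - θ t) := by abel
      rw [e]
      exact (enorm_add_le _ _).trans (add_le_add
        (le_iSup (fun t : I T => ‖ω t - η t‖ₑ) t) (le_iSup (fun t : I T => ‖η t - θ t‖ₑ) t))
    have h2 := hoelderLoc_add_le α T (incr fun t => ω t - η t) (incr fun t => η t - θ t)
    rw [← h] at h2
    calc _ ≤ _ := add_le_add h1 h2
      _ = _ := by simp only [hoelder]; abel

instance : MeasurableSpace (C0Path α T d) := borel _

instance : BorelSpace (C0Path α T d) := ⟨rfl⟩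

end C0Path

/-! ### The completed projective tensor product -/

section Tensor

variable {E : Type*} [NormedAddCommGroup E] [NormedSpace ℝ E]
variable {F : Type*} [NormedAddCommGroup F] [NormedSpace ℝ F]

variable (E) in
/-- `E ⊗ E`: the completion of the algebraic tensor product for the projective tensor norm. -/
abbrev PT : Type _ := UniformSpace.Completion (PiTensorProduct ℝ fun _ : Fin 2 => E)

/-- The elementary tensor `x ⊗ y`. -/
def tmul (x y : E) : PT E :=
  ((PiTensorProduct.tprod ℝ ![x, y] : PiTensorProduct ℝ fun _ : Fin 2 => E) : PT E)

/-- The continuous linear map on `E ⊗ E` induced by a continuous bilinear map. -/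
def ptLift [CompleteSpace F] (B : ContinuousMultilinearMap ℝ (fun _ : Fin 2 => E) F) :
    PT E →L[ℝ] F :=
  (PiTensorProduct.liftIsometry ℝ (fun _ : Fin 2 => E) F B).extend
    (UniformSpace.Completion.toComplL (𝕜 := ℝ) (E := PiTensorProduct ℝ fun _ : Fin 2 => E))

theorem ptLift_tmul [CompleteSpace F] (B : ContinuousMultilinearMap ℝ (fun _ : Fin 2 => E) F)
    (x y : E) : ptLift B (tmul x y) = B ![x, y] := by
  have h := ContinuousLinearMap.extend_eq
    (PiTensorProduct.liftIsometry ℝ (fun _ : Fin 2 => E) F B)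
    (e := UniformSpace.Completion.toComplL (𝕜 := ℝ) (E := PiTensorProduct ℝ fun _ : Fin 2 => E))
    (UniformSpace.Completion.denseRange_coe)
    (UniformSpace.Completion.isUniformInducing_coe _)
    (PiTensorProduct.tprod ℝ ![x, y])
  refine h.trans ?_
  simp

/-- The flip `x ⊗ y ↦ y ⊗ x`. -/
def ptSwap : PT E →L[ℝ] PT E :=
  ptLift (((UniformSpace.Completion.toComplL (𝕜 := ℝ)
    (E := PiTensorProduct ℝ fun _ : Fin 2 => E)).compContinuousMultilinearMap
      (PiTensorProduct.tprodL ℝ)).domDomCongr (Equiv.swap (0 : Fin 2) 1))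

theorem ptSwap_tmul (x y : E) : ptSwap (tmul x y) = tmul y x := by
  have h : (fun i : Fin 2 => (![x, y] : Fin 2 → E) (Equiv.swap (0 : Fin 2) 1 i)) = ![y, x] := by
    funext i; fin_cases i <;> simp
  rw [ptSwap, ptLift_tmul]
  simp [h, tmul]

/-- The symmetrization, `sym(x ⊗ y) = ½ (x ⊗ y + y ⊗ x)`. -/
def ptSym (A : PT E) : PT E := (1 / 2 : ℝ) • (A + ptSwap A)

/-- The coordinate `A^{l,k}` of `A ∈ ℝ^m ⊗ ℝ^m`, i.e. `(x ⊗ y)^{l,k} = x_l y_k`. -/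
def ptCoord {m : ℕ} (l k : Fin m) : PT (Rd m) →L[ℝ] ℝ :=
  ptLift ((ContinuousMultilinearMap.mkPiAlgebra ℝ (Fin 2) ℝ).compContinuousLinearMap
    fun i : Fin 2 => EuclideanSpace.proj (![l, k] i))

theorem ptCoord_tmul {m : ℕ} (l k : Fin m) (x y : Rd m) :
    ptCoord l k (tmul x y) = x l * y k := by
  simp [ptCoord, ptLift_tmul, Fin.prod_univ_two]

end Tensor

/-! ### Integrals as limits of Riemann sums -/

section Sums

variable {T : ℝ} {E : Type*} [NormedAddCommGroup E]

/-- `s = τ_0 < τ_1 < ⋯ < τ_n = t` is a partition of `[s,t]` of mesh less than `δ`. -/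
def IsPartition (s t : I T) (δ : ℝ) (n : ℕ) (τ : ℕ → I T) : Prop :=
  τ 0 = s ∧ τ n = t ∧ ∀ i < n, τ i < τ (i + 1) ∧ ((τ (i + 1) : ℝ) - τ i) < δ

/-- `lim_{|π| → 0} ∑_π g_{τ_i τ_{i+1}} = v` over the partitions `π` of `[s,t]`. -/
def HasSewing (g : I T → I T → E) (s t : I T) (v : E) : Prop :=
  ∀ ε > 0, ∃ δ > 0, ∀ (n : ℕ) (τ : ℕ → I T), IsPartition s t δ n τ →
    ‖∑ i ∈ Finset.range n, g (τ i) (τ (i + 1)) - v‖ < ε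

variable [NormedSpace ℝ E]

/-- The Riemann-Stieltjes integral `∫_s^t f_r ⊗ dx_r` exists and equals `v`: the sums
`∑_π f_{ξ_i} ⊗ (x_{τ_{i+1}} - x_{τ_i})`, with `ξ_i ∈ [τ_i, τ_{i+1}]`, converge to `v` as the
mesh tends to `0`. -/
def HasRSIntegral (f x : I T → E) (s t : I T) (v : PT E) : Prop :=
  ∀ ε > 0, ∃ δ > 0, ∀ (n : ℕ) (τ ξ : ℕ → I T), IsPartition s t δ n τ →
    (∀ i < n, τ i ≤ ξ i ∧ ξ i ≤ τ (i + 1)) →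
    ‖∑ i ∈ Finset.range n, tmul (f (ξ i)) (x (τ (i + 1)) - x (τ i)) - v‖ < ε

end Sums

/-! ### Rough paths -/

section RoughPaths

variable {T : ℝ} {E : Type*} [NormedAddCommGroup E] [NormedSpace ℝ E]

/-- `(X, XX) ∈ 𝒞^α([0,T];E)`. -/
structure IsRoughPath (α : ℝ) (X : I T → E) (XX : I T → I T → PT E) : Prop where
  path : MemC α X
  area : MemC2 (2 * α) XX
  chen : ∀ s u t : I T, s < u → u < t →
    XX s t - XX u t - XX s u = tmul (X u - X s) (X t - X u)

/-- Weakly geometric rough paths: `sym(XX_{st}) = ½ X_{st} ⊗ X_{st}`. -/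
structure IsWeaklyGeometric (α : ℝ) (X : I T → E) (XX : I T → I T → PT E) : Prop where
  rough : IsRoughPath α X XX
  sym : ∀ s t : I T, s < t → ptSym (XX s t) = (1 / 2 : ℝ) • tmul (X t - X s) (X t - X s)

/-- `(x, xx)` is the canonical lift of a path of bounded variation `x` (and it belongs to
`𝒞^α`): `xx_{st} = ∫_s^t (x_r - x_s) ⊗ dx_r`, a Riemann-Stieltjes integral. -/
structure IsBVLift (α : ℝ) (x : I T → E) (xx : I T → I T → PT E) : Prop where
  bv : BoundedVariationOn x univ
  rough : IsRoughPath α x xx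
  area_eq : ∀ s t : I T, s < t → HasRSIntegral (fun r => x r - x s) x s t (xx s t)

/-- The rough path distance `[X - Y]_α + [XX - YY]_{2α}`. -/
def roughDist (α : ℝ) (X : I T → E) (XX : I T → I T → PT E)
    (Y : I T → E) (YY : I T → I T → PT E) : ℝ≥0∞ :=
  hoelder α (incr fun t => X t - Y t) + hoelder (2 * α) (fun s t => XX s t - YY s t)

/-- Geometric rough paths `𝒞_g^α([0,T];E)`: the closure, in the rough path distance of `𝒞^α`,
of the set of (canonical lifts of) paths of bounded variation. -/
structure IsGeometric (α : ℝ) (X : I T → E) (XX : I T → I T → PT E) : Prop where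
  rough : IsRoughPath α X XX
  approx : ∀ ε : ℝ≥0∞, 0 < ε → ∃ (x : I T → E) (xx : I T → I T → PT E),
    IsBVLift α x xx ∧ roughDist α X XX x xx < ε

/-- `(Y, Y') ∈ 𝒟_Z^{2α}([0,T];E)` for `E`-valued `Y`, with the Gubinelli derivative `Y'`, an
`L(ℝ^m;E)`-valued path, given by its components: `Y' ∈ C^α` and
`δY_{st} - ∑_j Y'^j_s Z^j_{st} ∈ C_2^{2α}`. -/
structure IsControlled {m : ℕ} (α : ℝ) (Z : I T → Rd m) (Y : I T → E)
    (Y' : I T → Fin m → E) : Prop where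
  deriv : ∀ j, MemC α (fun t => Y' t j)
  remainder : MemC2 (2 * α) (fun s t => Y t - Y s - ∑ j, (Z t j - Z s j) • Y' s j)

/-- The rough path `(X, XX)` is obtained by rough integration of the `L(ℝ^m;E)`-valued controlled
path `(Y, Y')` against `(Z, ZZ)`; here `Y t i` is the component `Y^i` and `Y' t i l` is the
derivative `Y^{i,l}` of `Y^i` in the direction of `Z^l`. That is,
`X_t = ∫_0^t Y_r dZ_r` and `XX_{st} = ∫_s^t X_r ⊗ Y_r dZ_r - X_s ⊗ X_{st}`,
the integrals being the limits of the Riemann sums of the local expansions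
`Y_s^i Z^i_{st} + Y_s^{i,l} ZZ_{st}^{l,i}` and
`X_s ⊗ Y_s^i Z^i_{st} + (Y_s^l ⊗ Y_s^i + X_s ⊗ Y_s^{i,l}) ZZ_{st}^{l,i}`. -/
structure IsRoughIntegral {m : ℕ} (Z : I T → Rd m) (ZZ : I T → I T → PT (Rd m))
    (Y : I T → Fin m → E) (Y' : I T → Fin m → Fin m → E)
    (X : I T → E) (XX : I T → I T → PT E) : Prop where
  start : ∀ t : I T, (t : ℝ) = 0 → X t = 0
  path : ∀ s t : I T, s < t → HasSewing
    (fun u v => ∑ i, (Z v i - Z u i) • Y u i + ∑ i, ∑ l, ptCoord l i (ZZ u v) • Y' u i l)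
    s t (X t - X s)
  area : ∀ s t : I T, s < t → HasSewing
    (fun u v => ∑ i, (Z v i - Z u i) • tmul (X u) (Y u i)
      + ∑ i, ∑ l, ptCoord l i (ZZ u v) • (tmul (Y u l) (Y u i) + tmul (X u) (Y' u i l)))
    s t (XX s t + tmul (X s) (X t - X s))

end RoughPaths

/-! ### The Sobolev space `H^k = W^{k,2}(ℝ^d;ℝ^d)` -/

section Sobolev

variable {d : ℕ}

/-- The classical partial derivative `∂ψ/∂x_i`. -/
def partialD (i : Fin d) (ψ : Rd d → ℝ) : Rd d → ℝ :=
  fun x => fderiv ℝ ψ x (EuclideanSpace.single i 1)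

/-- `D^β ψ = ∂_1^{β_1} ⋯ ∂_d^{β_d} ψ`. -/
def multiD (β : Fin d → ℕ) (ψ : Rd d → ℝ) : Rd d → ℝ :=
  (List.finRange d).foldr (fun i g => (partialD i)^[β i] g) ψ

/-- `v` is the weak derivative `D^β u`. -/
structure HasWeakDeriv (β : Fin d → ℕ) (u v : Rd d → Rd d) : Prop where
  left : LocallyIntegrable u volume
  right : LocallyIntegrable v volume
  eq : ∀ ψ : Rd d → ℝ, ContDiff ℝ (⊤ : ℕ∞) ψ → HasCompactSupport ψ →
    ∫ x, multiD β ψ x • u x = (-1 : ℝ) ^ (∑ i, β i) • ∫ x, ψ x • v x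

/-- The multi-indices `β` with `|β| ≤ k`. -/
abbrev MultiIdx (d k : ℕ) : Type := {β : Fin d → Fin (k + 1) // ∑ i, (β i : ℕ) ≤ k}

/-- The multi-index `0`. -/
def zeroIdx (d k : ℕ) : MultiIdx d k := ⟨fun _ => 0, by simp⟩

theorem contDiff_multiD (β : Fin d → ℕ) {ψ : Rd d → ℝ} (h : ContDiff ℝ (⊤ : ℕ∞) ψ) :
    ContDiff ℝ (⊤ : ℕ∞) (multiD β ψ) := by
  have h1 : ∀ (i : Fin d) (g : Rd d → ℝ), ContDiff ℝ (⊤ : ℕ∞) g →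
      ContDiff ℝ (⊤ : ℕ∞) (partialD i g) := fun i g hg =>
    (hg.fderiv_right (m := (⊤ : ℕ∞)) (by simp)).clm_apply contDiff_const
  have h2 : ∀ (i : Fin d) (n : ℕ) (g : Rd d → ℝ), ContDiff ℝ (⊤ : ℕ∞) g →
      ContDiff ℝ (⊤ : ℕ∞) ((partialD i)^[n] g) := by
    intro i n
    induction n with
    | zero => exact fun g hg => hg
    | succ n ih => exact fun g hg => ih _ (h1 i g hg)
  unfold multiD
  induction List.finRange d with
  | nil => exact h
  | cons i l ih => exact h2 i _ _ ih

theorem hasCompactSupport_multiD (β : Fin d → ℕ) {ψ : Rd d → ℝ} (h : HasCompactSupport ψ) :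
    HasCompactSupport (multiD β ψ) := by
  have h1 : ∀ (i : Fin d) (g : Rd d → ℝ), HasCompactSupport g →
      HasCompactSupport (partialD i g) := fun i g hg => hg.fderiv_apply (𝕜 := ℝ) _
  have h2 : ∀ (i : Fin d) (n : ℕ) (g : Rd d → ℝ), HasCompactSupport g →
      HasCompactSupport ((partialD i)^[n] g) := by
    intro i n
    induction n with
    | zero => exact fun g hg => hg
    | succ n ih => exact fun g hg => ih _ (h1 i g hg)
  unfold multiD
  induction List.finRange d with
  | nil => exact h
  | cons i l ih => exact h2 i _ _ ih

theorem integrable_test_smul {ψ : Rd d → ℝ} (h : ContDiff ℝ (⊤ : ℕ∞) ψ)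
    (hc : HasCompactSupport ψ) {u : Rd d → Rd d} (hu : LocallyIntegrable u volume) :
    Integrable (fun x => ψ x • u x) volume :=
  hu.integrable_smul_left_of_hasCompactSupport h.continuous hc

theorem locallyIntegrable_Lp (u : Lp (Rd d) 2 (volume : Measure (Rd d))) :
    LocallyIntegrable (u : Rd d → Rd d) volume :=
  (Lp.memLp u).locallyIntegrable (by norm_num)

variable (d) in
/-- The Sobolev space `H^k = W^{k,2}(ℝ^d;ℝ^d)`. A function is stored together with its weak
derivatives, as the family `(D^β u)_{|β| ≤ k}` of elements of `L^2`; the norm inherited from the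
`ℓ^2`-product of the `L^2` spaces is `(∑_{|β| ≤ k} ‖D^β u‖_{L^2}^2)^{1/2}`. -/
def HkSub (k : ℕ) :
    Submodule ℝ (PiLp 2 fun _ : MultiIdx d k => Lp (Rd d) 2 (volume : Measure (Rd d))) where
  carrier := {u | ∀ β : MultiIdx d k,
    HasWeakDeriv (fun i => (β.1 i : ℕ)) (u (zeroIdx d k)) (u β)}
  zero_mem' := fun β => by
    refine ⟨locallyIntegrable_Lp _, locallyIntegrable_Lp _, fun ψ _ _ => ?_⟩
    have key : ∀ (g : Rd d → ℝ) (i : MultiIdx d k), ∫ x, g x • (((0 : PiLp 2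
        fun _ : MultiIdx d k => Lp (Rd d) 2 (volume : Measure (Rd d))) i : Rd d → Rd d) x) = 0 := by
      intro g i
      refine integral_eq_zero_of_ae ?_
      filter_upwards [Lp.coeFn_zero (Rd d) 2 (volume : Measure (Rd d))] with x hx
      exact (congrArg (g x • ·) hx).trans (smul_zero _)
    rw [key, key, smul_zero]
  add_mem' := fun {u v} hu hv β => by
    refine ⟨locallyIntegrable_Lp _, locallyIntegrable_Lp _, fun ψ h1 h2 => ?_⟩
    have hD1 := contDiff_multiD (fun i => (β.1 i : ℕ)) h1
    have hD2 := hasCompactSupport_multiD (fun i => (β.1 i : ℕ)) h2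
    have key : ∀ (g : Rd d → ℝ), ContDiff ℝ (⊤ : ℕ∞) g → HasCompactSupport g →
        ∀ i : MultiIdx d k, ∫ x, g x • ((u + v) i : Rd d → Rd d) x
          = (∫ x, g x • (u i : Rd d → Rd d) x) + ∫ x, g x • (v i : Rd d → Rd d) x := by
      intro g hg hgc i
      rw [← integral_add (integrable_test_smul hg hgc (locallyIntegrable_Lp _))
        (integrable_test_smul hg hgc (locallyIntegrable_Lp _))]
      refine integral_congr_ae ?_
      filter_upwards [Lp.coeFn_add (u i) (v i)] with x hx
      have : (u + v) i = u i + v i := rfl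
      rw [this, hx, Pi.add_apply, smul_add]
    rw [key _ hD1 hD2, key _ h1 h2, (hu β).eq ψ h1 h2, (hv β).eq ψ h1 h2, smul_add]
  smul_mem' := fun c u hu β => by
    refine ⟨locallyIntegrable_Lp _, locallyIntegrable_Lp _, fun ψ h1 h2 => ?_⟩
    have key : ∀ (g : Rd d → ℝ) (i : MultiIdx d k), ∫ x, g x • ((c • u) i : Rd d → Rd d) x
          = c • ∫ x, g x • (u i : Rd d → Rd d) x := by
      intro g i
      rw [← integral_smul]
      refine integral_congr_ae ?_
      filter_upwards [Lp.coeFn_smul c (u i)] with x hx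
      have : (c • u) i = c • u i := rfl
      rw [this, hx, Pi.smul_apply, smul_comm]
    rw [key, key, (hu β).eq ψ h1 h2, smul_comm]

variable (d) in
/-- `H^k` as a type. -/
abbrev Hk (k : ℕ) : Type := HkSub d k

/-- The `L^2`-class of an element of `H^k`. -/
def Hk.fn {k : ℕ} (u : Hk d k) : Lp (Rd d) 2 (volume : Measure (Rd d)) := u.1 (zeroIdx d k)

/-- The function `g` represents the element `u` of `H^k`. -/
def Represents {k : ℕ} (u : Hk d k) (g : Rd d → Rd d) : Prop := u.fn =ᵐ[volume] g

/-- The function `g` belongs to `H^k`. -/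
def MemHk (k : ℕ) (g : Rd d → Rd d) : Prop := ∃ u : Hk d k, Represents u g

open Classical in
/-- The element of `H^k` given by a function in `H^k` (and `0` for other functions). -/
def toHk (k : ℕ) (g : Rd d → Rd d) : Hk d k := if h : MemHk k g then h.choose else 0

/-! ### The spaces `C_b^3` and `C_b^3 ⊗ H^k` -/

/-- `g ∈ C_b^3(ℝ^d;ℝ^d)`: of class `C^3`, bounded with its derivatives up to order three. -/
def MemCb3 (g : Rd d → Rd d) : Prop :=
  ContDiff ℝ 3 g ∧ ∃ C : ℝ, ∀ i ≤ 3, ∀ x, ‖iteratedFDeriv ℝ i g x‖ ≤ C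

/-- `f ∈ C_b^3 ⊗ H^k`. The derivatives in the first variable are Frechet derivatives, those in the
second variable are weak derivatives, and the finiteness of the norm
`∑_{i ≤ 3, |β| ≤ k} sup_x ∫ |∇_1^i D_2^β f(x,y)|^2 dy` is expressed on the components of the
tensor `∇_1^i f`: the functions `y ↦ ∇_1^i f(x,y)(v_1,…,v_i)`, with `|v_j| ≤ 1`, are bounded in
`H^k` uniformly in `x`. -/
structure MemCb3Hk (k : ℕ) (f : Rd d → Rd d → Rd d) : Prop where
  cont : Continuous (Function.uncurry f)
  mem_right : ∀ x, MemHk k (f x)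
  mem_left : ∀ y, MemCb3 (fun x => f x y)
  bound : ∃ C : ℝ, ∀ i ≤ 3, ∀ x, ∀ v : Fin i → Rd d, (∀ j, ‖v j‖ ≤ 1) →
    ∃ u : Hk d k, Represents u (fun y => iteratedFDeriv ℝ i (fun x => f x y) x v) ∧ ‖u‖ ≤ C

end Sobolev

/-! ### Measures controlled by `Z` -/

section Measures

variable {T α : ℝ} {d m : ℕ}

/-- `μ(φ)_t = ∫ φ(ω_t, ·) dμ(ω)`. -/
def muPhi (μ : Measure (C0Path α T d)) (φ : Rd d → Rd d → Rd d) (t : I T) : Rd d → Rd d :=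
  fun y => ∫ ω, φ (ω t) y ∂μ

/-- `μ(∇_1 φ γ)_t^j = ∫ ∇_1 φ(ω_t, ·) γ_t^j(ω_t) dμ(ω)`. -/
def muGrad (μ : Measure (C0Path α T d)) (φ : Rd d → Rd d → Rd d)
    (γ : I T → Fin m → Rd d → Rd d) (t : I T) (j : Fin m) : Rd d → Rd d :=
  fun y => ∫ ω, fderiv ℝ (fun x => φ x y) (ω t) (γ t j (ω t)) ∂μ

/-- `(μ, γ) ∈ ℳ_Z^{2α,ρ}`: the pair `(μ, γ)`, with `μ ∈ 𝒫_ρ(C_0^α([0,T];ℝ^d))` and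
`γ ∈ C^α([0,T]; L(ℝ^m; C_b^3(ℝ^d;ℝ^d)))`, is controlled by `Z`. -/
structure IsControlledMeasure (k : ℕ) (ρ : ℝ) (Z : I T → Rd m)
    (μ : Measure (C0Path α T d)) (γ : I T → Fin m → Rd d → Rd d) : Prop where
  prob : IsProbabilityMeasure μ
  moment : ∫⁻ ω, hoelder α (incr ω.toFun) ^ ρ ∂μ < ∞
  gamma_mem : ∀ t j, MemCb3 (γ t j)
  gamma_hoelder : ∃ C : ℝ, ∀ s t : I T, s < t → ∀ j, ∀ i ≤ 3, ∀ x,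
    ‖iteratedFDeriv ℝ i (fun z => γ t j z - γ s j z) x‖ ≤ C * ((t : ℝ) - s) ^ α
  mem_phi : ∀ φ, MemCb3Hk k φ → ∀ t, MemHk k (muPhi μ φ t)
  mem_grad : ∀ φ, MemCb3Hk k φ → ∀ t j, MemHk k (muGrad μ φ γ t j)
  controlled : ∀ φ, MemCb3Hk k φ →
    IsControlled α Z (fun t => toHk k (muPhi μ φ t)) (fun t j => toHk k (muGrad μ φ γ t j))

end Measures

end RoughMV

end

open RoughMV

noncomputable section

namespace RoughMV

/-! ### Hoelder bounds as real inequalities -/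

section HoelderBounds

variable {T : ℝ} {E : Type*} [NormedAddCommGroup E]

/-! The argument works in an arbitrary Banach space `E`; in the end `E` is `H^k`, complete because
the relations defining weak derivatives are closed in `L^2`. The sewing lemma
`AlmostAdditive.exists_sewing` integrates controlled paths against `Z`. It produces `X` and, since
`X ⊗ Y` is again controlled (`IsControlledCoord.tmul_integral`), the path `J = ∫ X ⊗ Y dZ`. The
second level is `J_t - J_s - X_s ⊗ X_{st}`, for which Chen's relation is automatic.

The real issue is to approximate `(X, XX)` by lifts of paths of bounded variation. Up to
`O(|t-s|^{3α})` the second level is a combination of the finitely many tensors `Y^l_s ⊗ Y^i_s` with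
the coordinates of `ZZ` as coefficients. Weak geometricity fixes the symmetric part of `ZZ`, so
(`IsControlledCoord.areaOf_antisymm`) what remains beyond `½ X_{st} ⊗ X_{st}` is a finite sum of
terms `c (Y^l ⊗ Y^i - Y^i ⊗ Y^l)` with `c` of order `|t-s|^{2β}`, where `β` is the exponent of `Z`.
Each such term is the area of a parallelogram with sides of order `|t-s|^β`.

On a uniform grid of mesh `h`, let `x` run in each cell through these parallelograms and then along
the chord of `X` (`exists_lipschitz_interpolation`). On the grid `x` has the increments of `X`, so
the cross terms in Chen's relation cancel and area errors merely add up: `|t-s|/h` cells with error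
`h^{3α}` give `h^{3α-1} |t-s|`, which is small since `3α > 1`. Inside a cell `x` has a Lipschitz
constant of order `h^{β-1}`, and `β > α` makes both lifts small at exponent `α`.
`norm_sub_le_of_grid` combines the two regimes, and `isGeometric_areaOf` chooses `h` small. -/

theorem coe_sub_pos {s t : I T} (hst : s < t) : 0 < (t : ℝ) - s :=
  sub_pos.2 (Subtype.coe_lt_coe.2 hst)

theorem coe_sub_nonneg {s t : I T} (hst : s ≤ t) : 0 ≤ (t : ℝ) - s :=
  sub_nonneg.2 (Subtype.coe_le_coe.2 hst)

theorem coe_sub_le (s t : I T) : (t : ℝ) - s ≤ T := by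
  have := t.2.2
  have := s.2.1
  linarith

theorem hoelder_le {ζ C : ℝ} {g : I T → I T → E}
    (h : ∀ s t : I T, s < t → ‖g s t‖ ≤ C * ((t : ℝ) - s) ^ ζ) :
    hoelder ζ g ≤ ENNReal.ofReal C := by
  refine iSup_le fun s => iSup_le fun t => iSup_le fun hst => iSup_le fun _ => ?_
  have hpos : 0 < ((t : ℝ) - s) ^ ζ := Real.rpow_pos_of_pos (coe_sub_pos hst) _
  rw [← ofReal_norm, ← ENNReal.ofReal_div_of_pos hpos]
  exact ENNReal.ofReal_le_ofReal ((div_le_iff₀ hpos).2 (h s t hst))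

theorem exists_bound_of_hoelder_lt_top {ζ : ℝ} {g : I T → I T → E} (h : hoelder ζ g < ∞) :
    ∃ C : ℝ, 0 ≤ C ∧ ∀ s t : I T, s < t → ‖g s t‖ ≤ C * ((t : ℝ) - s) ^ ζ := by
  refine ⟨(hoelder ζ g).toReal, ENNReal.toReal_nonneg, fun s t hst => ?_⟩
  have hpos : 0 < ((t : ℝ) - s) ^ ζ := Real.rpow_pos_of_pos (coe_sub_pos hst) _
  have hle : ‖g s t‖ₑ / ENNReal.ofReal (((t : ℝ) - s) ^ ζ) ≤ hoelder ζ g :=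
    le_iSup_of_le s (le_iSup_of_le t (le_iSup_of_le hst (le_iSup_of_le (coe_sub_le s t) le_rfl)))
  rw [← ofReal_norm, ← ENNReal.ofReal_div_of_pos hpos] at hle
  exact (div_le_iff₀ hpos).1 ((ENNReal.ofReal_le_iff_le_toReal h.ne).1 hle)

theorem continuous_of_bound {ζ C : ℝ} (hζ : 0 < ζ) {f : I T → E}
    (h : ∀ s t : I T, s < t → ‖f t - f s‖ ≤ C * ((t : ℝ) - s) ^ ζ) : Continuous f := by
  have hC : ∀ s t : I T, ‖f t - f s‖ ≤ |C| * |(t : ℝ) - s| ^ ζ := by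
    intro s t
    rcases lt_trichotomy s t with hst | rfl | hst
    · rw [abs_of_pos (coe_sub_pos hst)]
      exact (h s t hst).trans (mul_le_mul_of_nonneg_right (le_abs_self C)
        (Real.rpow_nonneg (coe_sub_nonneg hst.le) _))
    · simp only [sub_self, norm_zero]
      positivity
    · rw [abs_sub_comm, abs_of_pos (coe_sub_pos hst), norm_sub_rev]
      exact (h t s hst).trans (mul_le_mul_of_nonneg_right (le_abs_self C)
        (Real.rpow_nonneg (coe_sub_nonneg hst.le) _))
  rw [continuous_iff_continuousAt]
  intro s
  rw [ContinuousAt, tendsto_iff_norm_sub_tendsto_zero]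
  refine squeeze_zero (fun t => norm_nonneg _) (fun t => hC s t) ?_
  have hc : Continuous fun t : I T => |C| * |(t : ℝ) - s| ^ ζ :=
    continuous_const.mul
      (((continuous_subtype_val.sub continuous_const).abs).rpow_const fun _ => Or.inr hζ.le)
  have := hc.tendsto s
  simpa [Real.zero_rpow hζ.ne'] using this

theorem memC_of_bound {ζ C : ℝ} (hζ : 0 < ζ) {f : I T → E}
    (h : ∀ s t : I T, s < t → ‖f t - f s‖ ≤ C * ((t : ℝ) - s) ^ ζ) : MemC ζ f := by
  have hc := continuous_of_bound hζ h
  exact ⟨((hc.comp continuous_snd).sub (hc.comp continuous_fst)).continuousOn,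
    (hoelder_le h).trans_lt ENNReal.ofReal_lt_top⟩

theorem exists_norm_le_of_bound {ζ C : ℝ} (hζ : 0 < ζ) {f : I T → E}
    (h : ∀ s t : I T, s < t → ‖f t - f s‖ ≤ C * ((t : ℝ) - s) ^ ζ) :
    ∃ A : ℝ, ∀ t, ‖f t‖ ≤ A := by
  obtain ⟨A, hA⟩ := (isCompact_univ (X := I T)).exists_bound_of_continuousOn
    (continuous_of_bound hζ h).continuousOn
  exact ⟨A, fun t => hA t (mem_univ t)⟩

/-- Trading a positive power of the length of an interval for a lower Hoelder exponent. -/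
theorem rpow_le_rpow_mul_rpow {x h a b : ℝ} (hx : 0 < x) (hxh : x ≤ h) (hab : a ≤ b) :
    x ^ b ≤ h ^ (b - a) * x ^ a := by
  have e : x ^ b = x ^ (b - a) * x ^ a := by rw [← Real.rpow_add hx]; congr 1; ring
  rw [e]
  gcongr

end HoelderBounds

/-! ### The elementary tensors as a bounded bilinear map -/

section Tensor

variable {E : Type*} [NormedAddCommGroup E] [NormedSpace ℝ E]

theorem norm_tmul_le (x y : E) : ‖tmul x y‖ ≤ ‖x‖ * ‖y‖ := by
  rw [tmul, UniformSpace.Completion.norm_coe]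
  simpa [Fin.prod_univ_two] using
    PiTensorProduct.projectiveSeminorm_tprod_le (𝕜 := ℝ) (E := fun _ : Fin 2 => E) ![x, y]

/-- Multilinearity of `tprod` is stated through `Function.update`; the overwritten entry `z` is a
free placeholder. -/
theorem tmul_eq_update_zero (x y z : E) :
    tmul x y = ((PiTensorProduct.tprod ℝ (Function.update ![z, y] 0 x) :
      PiTensorProduct ℝ fun _ : Fin 2 => E) : PT E) := by
  rw [tmul]; congr 2; funext i; fin_cases i <;> simp

theorem tmul_eq_update_one (x y z : E) :
    tmul x y = ((PiTensorProduct.tprod ℝ (Function.update ![x, z] 1 y) :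
      PiTensorProduct ℝ fun _ : Fin 2 => E) : PT E) := by
  rw [tmul]; congr 2; funext i; fin_cases i <;> simp

variable (E) in
/-- `(x, y) ↦ x ⊗ y` as a continuous bilinear map. -/
def tmulL : E →L[ℝ] E →L[ℝ] PT E :=
  LinearMap.mkContinuous₂ (LinearMap.mk₂ ℝ tmul
    (fun x x' y => by
      rw [tmul_eq_update_zero (x + x') y 0, tmul_eq_update_zero x y 0, tmul_eq_update_zero x' y 0,
        MultilinearMap.map_update_add, UniformSpace.Completion.coe_add])
    (fun c x y => by
      rw [tmul_eq_update_zero (c • x) y 0, tmul_eq_update_zero x y 0,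
        MultilinearMap.map_update_smul, UniformSpace.Completion.coe_smul])
    (fun x y y' => by
      rw [tmul_eq_update_one x (y + y') 0, tmul_eq_update_one x y 0, tmul_eq_update_one x y' 0,
        MultilinearMap.map_update_add, UniformSpace.Completion.coe_add])
    (fun c x y => by
      rw [tmul_eq_update_one x (c • y) 0, tmul_eq_update_one x y 0,
        MultilinearMap.map_update_smul, UniformSpace.Completion.coe_smul])) 1
    (fun x y => by simpa using norm_tmul_le x y)

theorem tmulL_apply (x y : E) : tmulL E x y = tmul x y := rfl

theorem add_tmul (x x' y : E) : tmul (x + x') y = tmul x y + tmul x' y := by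
  simp only [← tmulL_apply, map_add, _root_.add_apply]

theorem tmul_add (x y y' : E) : tmul x (y + y') = tmul x y + tmul x y' := by
  simp only [← tmulL_apply, map_add]

theorem sub_tmul (x x' y : E) : tmul (x - x') y = tmul x y - tmul x' y := by
  simp only [← tmulL_apply, map_sub, _root_.sub_apply]

theorem tmul_sub (x y y' : E) : tmul x (y - y') = tmul x y - tmul x y' := by
  simp only [← tmulL_apply, map_sub]

theorem neg_tmul (x y : E) : tmul (-x) y = -tmul x y := by
  simp only [← tmulL_apply, map_neg, _root_.neg_apply]

theorem tmul_neg (x y : E) : tmul x (-y) = -tmul x y := by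
  simp only [← tmulL_apply, map_neg]

theorem smul_tmul (c : ℝ) (x y : E) : tmul (c • x) y = c • tmul x y := by
  simp only [← tmulL_apply, map_smul, _root_.smul_apply]

theorem tmul_smul (c : ℝ) (x y : E) : tmul x (c • y) = c • tmul x y := by
  simp only [← tmulL_apply, map_smul]

theorem zero_tmul (y : E) : tmul 0 y = 0 := by
  simp only [← tmulL_apply, map_zero, _root_.zero_apply]

theorem tmul_zero (x : E) : tmul x 0 = 0 := by
  simp only [← tmulL_apply, map_zero]

theorem sum_tmul {ι : Type*} (s : Finset ι) (f : ι → E) (y : E) :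
    tmul (∑ i ∈ s, f i) y = ∑ i ∈ s, tmul (f i) y := by
  simp only [← tmulL_apply, map_sum, _root_.sum_apply]

theorem tmul_sum {ι : Type*} (s : Finset ι) (f : ι → E) (x : E) :
    tmul x (∑ i ∈ s, f i) = ∑ i ∈ s, tmul x (f i) := by
  simp only [← tmulL_apply, map_sum]

theorem continuous_tmul {S : Type*} [TopologicalSpace S] {f g : S → E} (hf : Continuous f)
    (hg : Continuous g) : Continuous fun p => tmul (f p) (g p) :=
  ((tmulL E).continuous.comp hf).clm_apply hg

/-- Elementary tensors span the algebraic tensor product, which is dense in its completion. -/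
theorem ext_tmul {F : Type*} [NormedAddCommGroup F] [NormedSpace ℝ F] {A B : PT E →L[ℝ] F}
    (h : ∀ x y, A (tmul x y) = B (tmul x y)) : A = B := by
  have key : ∀ a : PiTensorProduct ℝ fun _ : Fin 2 => E, A (a : PT E) = B (a : PT E) := by
    intro a
    induction a using PiTensorProduct.induction_on with
    | smul_tprod r f =>
      have e : f = ![f 0, f 1] := by funext i; fin_cases i <;> rfl
      rw [UniformSpace.Completion.coe_smul, map_smul, map_smul, e]
      exact congrArg _ (h _ _)
    | add a b ha hb => rw [UniformSpace.Completion.coe_add, map_add, map_add, ha, hb]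
  ext a
  exact UniformSpace.Completion.induction_on a (isClosed_eq A.continuous B.continuous) key

theorem ptCoord_ptSwap {m : ℕ} (l i : Fin m) (A : PT (Rd m)) :
    ptCoord l i (ptSwap A) = ptCoord i l A := by
  have h : (ptCoord l i).comp ptSwap = ptCoord i l := ext_tmul fun x y => by
    simp only [ContinuousLinearMap.comp_apply, ptSwap_tmul, ptCoord_tmul, mul_comm]
  exact DFunLike.congr_fun h A

end Tensor

/-! ### Completeness of `H^k` -/

section Complete

variable {d k : ℕ}

/-- Testing against a smooth compactly supported function is continuous on `L^2`. -/
theorem continuous_integral_test_smul {ψ : Rd d → ℝ} (h : ContDiff ℝ (⊤ : ℕ∞) ψ)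
    (hc : HasCompactSupport ψ) :
    Continuous fun u : Lp (Rd d) 2 (volume : Measure (Rd d)) => ∫ x, ψ x • u x := by
  have hψ : MemLp ψ 2 (volume : Measure (Rd d)) := h.continuous.memLp_of_hasCompactSupport hc
  -- The functional is the `L^2` duality pairing with the class of `ψ`.
  have e : (fun u : Lp (Rd d) 2 (volume : Measure (Rd d)) => ∫ x, ψ x • u x)
      = (ContinuousLinearMap.lsmul ℝ ℝ).lpPairing volume 2 2 hψ.toLp := by
    funext u
    rw [ContinuousLinearMap.lpPairing_eq_integral]
    refine integral_congr_ae ?_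
    filter_upwards [hψ.coeFn_toLp] with x hx
    simp [hx]
  rw [e]
  exact ContinuousLinearMap.continuous _

/-- For a fixed test function, the defining identity equates two continuous functions of the family
`(D^β u)`; local integrability is automatic in `L^2`. -/
theorem isClosed_HkSub : IsClosed (HkSub d k : Set (PiLp 2 fun _ : MultiIdx d k =>
    Lp (Rd d) 2 (volume : Measure (Rd d)))) := by
  have e : (HkSub d k : Set (PiLp 2 fun _ : MultiIdx d k =>
      Lp (Rd d) 2 (volume : Measure (Rd d)))) =
      ⋂ β : MultiIdx d k, ⋂ ψ : Rd d → ℝ, ⋂ _ : ContDiff ℝ (⊤ : ℕ∞) ψ,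
        ⋂ _ : HasCompactSupport ψ, {u | ∫ x, multiD (fun i => (β.1 i : ℕ)) ψ x • u (zeroIdx d k) x
          = (-1 : ℝ) ^ (∑ i, (β.1 i : ℕ)) • ∫ x, ψ x • u β x} := by
    ext u
    simp only [mem_iInter, mem_ofPred_eq]
    exact ⟨fun hu β ψ h1 h2 => (hu β).eq ψ h1 h2, fun hu β =>
      ⟨locallyIntegrable_Lp _, locallyIntegrable_Lp _, fun ψ h1 h2 => hu β ψ h1 h2⟩⟩
  rw [e]
  refine isClosed_iInter fun β => isClosed_iInter fun ψ => isClosed_iInter fun h1 =>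
    isClosed_iInter fun h2 => isClosed_eq ?_ ?_
  · exact (continuous_integral_test_smul (contDiff_multiD _ h1)
      (hasCompactSupport_multiD _ h2)).comp (PiLp.continuous_apply 2 _ _)
  · have h := (continuous_integral_test_smul h1 h2).comp
      (PiLp.continuous_apply 2 (fun _ : MultiIdx d k =>
        Lp (Rd d) 2 (volume : Measure (Rd d))) β)
    exact (continuous_const_smul ((-1 : ℝ) ^ (∑ i, (β.1 i : ℕ)))).comp h

instance : CompleteSpace (Hk d k) := isClosed_HkSub.completeSpace_coe

end Complete

/-! ### The sewing lemma -/

section Sewing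

variable {T : ℝ} {E : Type*} [NormedAddCommGroup E]

/-- `g` vanishes on the diagonal and `‖g_{st} - g_{su} - g_{ut}‖ ≤ K |t-s|^θ` with `θ > 1`. -/
structure AlmostAdditive (θ K : ℝ) (g : I T → I T → E) : Prop where
  one_lt : 1 < θ
  nonneg : 0 ≤ K
  diag : ∀ s, g s s = 0
  defect : ∀ s u t : I T, s ≤ u → u ≤ t →
    ‖g s t - g s u - g u t‖ ≤ K * ((t : ℝ) - s) ^ θ

/-- The constant of the sewing lemma. -/
def sewConst (θ : ℝ) : ℝ := 2 / (1 - 2 ^ (1 - θ))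

theorem two_rpow_one_sub_lt_one {θ : ℝ} (hθ : 1 < θ) : (2 : ℝ) ^ (1 - θ) < 1 :=
  Real.rpow_lt_one_of_one_lt_of_neg one_lt_two (by linarith)

theorem sewConst_pos {θ : ℝ} (hθ : 1 < θ) : 0 < sewConst θ :=
  div_pos two_pos (sub_pos.2 (two_rpow_one_sub_lt_one hθ))

/-- The identity that closes the induction in the maximal inequality: two halves plus two defects
reproduce the same constant. -/
theorem sewConst_halving {θ : ℝ} (hθ : 1 < θ) {L : ℝ} (hL : 0 ≤ L) :
    2 * (sewConst θ * (L / 2) ^ θ) + 2 * L ^ θ = sewConst θ * L ^ θ := by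
  have h1 : sewConst θ * (1 - 2 ^ (1 - θ)) = 2 :=
    div_mul_cancel₀ _ (sub_pos.2 (two_rpow_one_sub_lt_one hθ)).ne'
  have h2 : 2 * (L / 2) ^ θ = 2 ^ (1 - θ) * L ^ θ := by
    rw [Real.div_rpow hL two_pos.le, Real.rpow_sub two_pos, Real.rpow_one]
    ring
  linear_combination sewConst θ * h2 - L ^ θ * h1

/-- A bound independent of the number of points, by induction on that number. The interval is cut
around the single step that crosses its midpoint; both remaining pieces have at most half the
length, and `θ > 1` makes halving gain a factor. -/
theorem AlmostAdditive.norm_sum_sub_le {θ K : ℝ} {g : I T → I T → E}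
    (hg : AlmostAdditive θ K g) {τ : ℕ → I T} (hτ : Monotone τ) {a b : ℕ} (hab : a ≤ b) :
    ‖∑ i ∈ Finset.Ico a b, g (τ i) (τ (i + 1)) - g (τ a) (τ b)‖
      ≤ sewConst θ * K * ((τ b : ℝ) - τ a) ^ θ := by
  have hK := hg.nonneg
  have hC := (sewConst_pos hg.one_lt).le
  induction hn : b - a using Nat.strong_induction_on generalizing a b with
  | _ n ih =>
    rcases hab.eq_or_lt with rfl | hlt
    · simp only [Finset.Ico_self, Finset.sum_empty, hg.diag, sub_self, norm_zero]
      positivity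
    have hL := coe_sub_nonneg (hτ hab)
    set L : ℝ := (τ b : ℝ) - τ a with hLdef
    -- `c` is the last index before `b` whose point lies in the first half; the step from `c` to `c
    -- + 1` is split off.
    obtain ⟨c, hac, hcb, hc1, hc2⟩ : ∃ c, a ≤ c ∧ c < b ∧ (τ c : ℝ) - τ a ≤ L / 2 ∧
        (τ b : ℝ) - τ (c + 1) ≤ L / 2 := by
      have hne : ((Finset.Ico a b).filter fun i => (τ i : ℝ) - τ a ≤ L / 2).Nonempty :=
        ⟨a, by simp only [Finset.mem_filter, Finset.mem_Ico]; exact ⟨⟨le_rfl, hlt⟩, by linarith⟩⟩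
      have hmem := Finset.max'_mem _ hne
      have hmax := fun i hi => Finset.le_max'
        ((Finset.Ico a b).filter fun i => (τ i : ℝ) - τ a ≤ L / 2) i hi
      set c := Finset.max' _ hne
      simp only [Finset.mem_filter, Finset.mem_Ico] at hmem hmax
      refine ⟨c, hmem.1.1, hmem.1.2, hmem.2, ?_⟩
      by_contra! hcon
      have hcb : c + 1 ≠ b := by
        intro h
        rw [h] at hcon
        linarith
      have := hmax (c + 1) ⟨⟨by omega, by omega⟩, by linarith⟩
      omega
    have e1 := ih (c - a) (by omega) hac rfl
    have e2 := ih (b - (c + 1)) (by omega) (Nat.succ_le_of_lt hcb) rfl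
    have hle1 : τ a ≤ τ c := hτ hac
    have hle2 : τ c ≤ τ (c + 1) := hτ (Nat.le_succ c)
    have hle3 : τ (c + 1) ≤ τ b := hτ (Nat.succ_le_of_lt hcb)
    have d1 := hg.defect (τ a) (τ c) (τ b) hle1 (hle2.trans hle3)
    have d2 := hg.defect (τ c) (τ (c + 1)) (τ b) hle2 hle3
    have f1 : ((τ c : ℝ) - τ a) ^ θ ≤ (L / 2) ^ θ :=
      Real.rpow_le_rpow (coe_sub_nonneg hle1) hc1 (by linarith [hg.one_lt])
    have f2 : ((τ b : ℝ) - τ (c + 1)) ^ θ ≤ (L / 2) ^ θ :=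
      Real.rpow_le_rpow (coe_sub_nonneg hle3) hc2 (by linarith [hg.one_lt])
    have f3 : ((τ b : ℝ) - τ c) ^ θ ≤ L ^ θ :=
      Real.rpow_le_rpow (coe_sub_nonneg (hle2.trans hle3))
        (by have := coe_sub_nonneg hle1; linarith) (by linarith [hg.one_lt])
    have esum : ∑ i ∈ Finset.Ico a b, g (τ i) (τ (i + 1)) - g (τ a) (τ b)
        = (∑ i ∈ Finset.Ico a c, g (τ i) (τ (i + 1)) - g (τ a) (τ c))
          + (∑ i ∈ Finset.Ico (c + 1) b, g (τ i) (τ (i + 1)) - g (τ (c + 1)) (τ b))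
          - (g (τ a) (τ b) - g (τ a) (τ c) - g (τ c) (τ b))
          - (g (τ c) (τ b) - g (τ c) (τ (c + 1)) - g (τ (c + 1)) (τ b)) := by
      rw [← Finset.sum_Ico_consecutive _ hac hcb.le, Finset.sum_eq_sum_Ico_succ_bot hcb]
      abel
    rw [esum]
    calc _ ≤ sewConst θ * K * ((τ c : ℝ) - τ a) ^ θ
          + sewConst θ * K * ((τ b : ℝ) - τ (c + 1)) ^ θ
          + K * L ^ θ + K * ((τ b : ℝ) - τ c) ^ θ :=
        (norm_sub_le _ _).trans (add_le_add ((norm_sub_le _ _).trans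
          (add_le_add ((norm_add_le _ _).trans (add_le_add e1 e2)) d1)) d2)
      _ ≤ sewConst θ * K * (L / 2) ^ θ + sewConst θ * K * (L / 2) ^ θ
          + K * L ^ θ + K * L ^ θ := by gcongr
      _ = K * (2 * (sewConst θ * (L / 2) ^ θ) + 2 * L ^ θ) := by ring
      _ = sewConst θ * K * L ^ θ := by rw [sewConst_halving hg.one_lt hL]; ring

/-! ### Dyadic Riemann sums -/

theorem coe_min_sub_coe_min_le (t : I T) {p q : I T} (hpq : p ≤ q) :
    ((min t q : I T) : ℝ) - (min t p : I T) ≤ (q : ℝ) - p := by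
  have hpq' : (p : ℝ) ≤ q := hpq
  rcases le_total t p with h | h
  · rw [min_eq_left h, min_eq_left (h.trans hpq)]
    linarith
  · rw [min_eq_right h]
    have : ((min t q : I T) : ℝ) ≤ q := min_le_right t q
    linarith

/-- The dyadic grid point `j T / 2^n`. -/
def dyadic (hT : 0 ≤ T) (n j : ℕ) : I T := projIcc 0 T hT (j * T / 2 ^ n)

theorem dyadic_mono (hT : 0 ≤ T) (n : ℕ) : Monotone (dyadic hT n) := fun i j hij =>
  monotone_projIcc hT (by gcongr)

theorem dyadic_zero (hT : 0 ≤ T) (n : ℕ) : (dyadic hT n 0 : ℝ) = 0 := by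
  simp [dyadic]

theorem dyadic_last (hT : 0 ≤ T) (n : ℕ) : (dyadic hT n (2 ^ n) : ℝ) = T := by
  simp [dyadic]

theorem dyadic_two_mul (hT : 0 ≤ T) (n j : ℕ) :
    dyadic hT (n + 1) (2 * j) = dyadic hT n j := by
  rw [dyadic, dyadic]
  congr 1
  push_cast
  field_simp
  ring

theorem dyadic_succ_sub (hT : 0 ≤ T) (n j : ℕ) :
    (dyadic hT n (j + 1) : ℝ) - dyadic hT n j ≤ T / 2 ^ n := by
  have h := abs_projIcc_sub_projIcc (a := (0 : ℝ)) (b := T) hT (c := ((j + 1 : ℕ) : ℝ) * T / 2 ^ n)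
    (d := (j : ℝ) * T / 2 ^ n)
  have e : ((j + 1 : ℕ) : ℝ) * T / 2 ^ n - (j : ℝ) * T / 2 ^ n = T / 2 ^ n := by
    push_cast
    ring
  rw [e, abs_of_nonneg (show (0 : ℝ) ≤ T / 2 ^ n by positivity)] at h
  exact (le_abs_self _).trans h

/-- The Riemann sum of `g` over the dyadic partition of level `n` of `[0,t]`. -/
def dyadicSum (hT : 0 ≤ T) (g : I T → I T → E) (n : ℕ) (t : I T) : E :=
  ∑ j ∈ Finset.range (2 ^ n), g (min t (dyadic hT n j)) (min t (dyadic hT n (j + 1)))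

theorem sum_range_two_mul (f : ℕ → E) (N : ℕ) :
    ∑ i ∈ Finset.range (2 * N), f i = ∑ j ∈ Finset.range N, (f (2 * j) + f (2 * j + 1)) := by
  induction N with
  | zero => simp
  | succ N ih => rw [Finset.sum_range_succ, ← ih, mul_add, mul_one, Finset.sum_range_succ,
      Finset.sum_range_succ, add_assoc]

/-- The number of cells times the defect per cell decays geometrically, with ratio `2^(1-θ) < 1`. -/
theorem two_pow_mul_mesh (hT : 0 ≤ T) (θ K : ℝ) (n : ℕ) :
    ∑ _j ∈ Finset.range (2 ^ n), K * (T / 2 ^ n) ^ θ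
      = K * T ^ θ * ((2 : ℝ) ^ (1 - θ)) ^ n := by
  rw [Finset.sum_const, Finset.card_range, nsmul_eq_mul, Real.div_rpow hT (by positivity),
    ← Real.rpow_natCast, ← Real.rpow_natCast, ← Real.rpow_mul two_pos.le,
    ← Real.rpow_mul two_pos.le, sub_mul, one_mul, Real.rpow_sub two_pos, mul_comm θ]
  push_cast
  rw [Real.rpow_natCast]
  ring

theorem AlmostAdditive.defect_le {θ K : ℝ} {g : I T → I T → E}
    (hg : AlmostAdditive θ K g) {s u t : I T} (h1 : s ≤ u) (h2 : u ≤ t) {h : ℝ}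
    (hh : (t : ℝ) - s ≤ h) : ‖g s t - g s u - g u t‖ ≤ K * h ^ θ :=
  (hg.defect s u t h1 h2).trans (mul_le_mul_of_nonneg_left
    (Real.rpow_le_rpow (coe_sub_nonneg (h1.trans h2)) hh (by linarith [hg.one_lt])) hg.nonneg)

/-- Refining inserts one point into each cell and costs one defect there. Cells beyond `t` are
collapsed by the truncation and contribute nothing. -/
theorem AlmostAdditive.dist_dyadicSum_succ {θ K : ℝ} {g : I T → I T → E} (hT : 0 ≤ T)
    (hg : AlmostAdditive θ K g) (t : I T) (n : ℕ) :
    dist (dyadicSum hT g n t) (dyadicSum hT g (n + 1) t)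
      ≤ K * T ^ θ * ((2 : ℝ) ^ (1 - θ)) ^ n := by
  rw [dist_eq_norm, dyadicSum, dyadicSum, pow_succ', sum_range_two_mul, ← Finset.sum_sub_distrib,
    ← two_pow_mul_mesh hT]
  refine norm_sum_le_of_le _ fun j _ => ?_
  have e : dyadic hT (n + 1) (2 * j + 1 + 1) = dyadic hT n (j + 1) := dyadic_two_mul hT n (j + 1)
  rw [e, dyadic_two_mul, ← sub_sub]
  have m1 : dyadic hT n j ≤ dyadic hT (n + 1) (2 * j + 1) := by
    rw [← dyadic_two_mul]
    exact dyadic_mono hT _ (Nat.le_succ _)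
  have m2 : dyadic hT (n + 1) (2 * j + 1) ≤ dyadic hT n (j + 1) := by
    rw [← e]
    exact dyadic_mono hT _ (Nat.le_succ _)
  exact hg.defect_le (min_le_min_left t m1) (min_le_min_left t m2)
    ((coe_min_sub_coe_min_le t (m1.trans m2)).trans (dyadic_succ_sub hT n j))

/-- Clamping the dyadic points to `[s,t]` gives a chain to which the maximal inequality applies. The
difference of the sums up to `t` and up to `s` agrees with the sum over this chain except in the
cell containing `s`. -/
theorem AlmostAdditive.norm_dyadicSum_sub_le {θ K : ℝ} {g : I T → I T → E} (hT : 0 ≤ T)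
    (hg : AlmostAdditive θ K g) {s t : I T} (hst : s ≤ t) (n : ℕ) :
    ‖dyadicSum hT g n t - dyadicSum hT g n s - g s t‖
      ≤ K * T ^ θ * ((2 : ℝ) ^ (1 - θ)) ^ n + sewConst θ * K * ((t : ℝ) - s) ^ θ := by
  set τ : ℕ → I T := fun j => max s (min t (dyadic hT n j)) with hτdef
  have hτ : Monotone τ := fun i j hij =>
    max_le_max le_rfl (min_le_min le_rfl (dyadic_mono hT n hij))
  have h0 : τ 0 = s := by
    have : dyadic hT n 0 ≤ s := by
      rw [← Subtype.coe_le_coe, dyadic_zero]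
      exact s.2.1
    exact max_eq_left ((min_le_right _ _).trans this)
  have h1 : τ (2 ^ n) = t := by
    have : t ≤ dyadic hT n (2 ^ n) := by
      rw [← Subtype.coe_le_coe, dyadic_last]
      exact t.2.2
    rw [hτdef]
    simp only [min_eq_left this, max_eq_right hst]
  have hmax := hg.norm_sum_sub_le hτ (Nat.zero_le (2 ^ n))
  rw [h0, h1, ← Finset.range_eq_Ico] at hmax
  have hlocal : ‖dyadicSum hT g n t - dyadicSum hT g n s
      - ∑ j ∈ Finset.range (2 ^ n), g (τ j) (τ (j + 1))‖
      ≤ K * T ^ θ * ((2 : ℝ) ^ (1 - θ)) ^ n := by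
    rw [dyadicSum, dyadicSum, ← Finset.sum_sub_distrib, ← Finset.sum_sub_distrib,
      ← two_pow_mul_mesh hT]
    -- Only the cell around `s` has a defect; charging every cell is wasteful, but the total still
    -- tends to `0`.
    refine norm_sum_le_of_le _ fun j _ => ?_
    have hj := dyadic_mono hT n (Nat.le_succ j)
    have hmesh := dyadic_succ_sub hT n j
    have hpos : 0 ≤ K * (T / 2 ^ n) ^ θ :=
      mul_nonneg hg.nonneg (Real.rpow_nonneg (by positivity) _)
    simp only [hτdef]
    set p := dyadic hT n j
    set q := dyadic hT n (j + 1)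
    rcases le_total s p with hp | hp
    · have hq := hp.trans hj
      rw [min_eq_left hp, min_eq_left hq, hg.diag, max_eq_right (le_min hst hp),
        max_eq_right (le_min hst hq)]
      simpa using hpos
    · rw [min_eq_right hp, min_eq_right (hp.trans hst), max_eq_left hp]
      rcases le_total s q with hq | hq
      · rw [min_eq_left hq, max_eq_right (le_min hst hq)]
        refine hg.defect_le hp (le_min hst hq) (le_trans ?_ hmesh)
        have : ((min t q : I T) : ℝ) ≤ q := min_le_right t q
        linarith
      · rw [min_eq_right hq, min_eq_right (hq.trans hst), max_eq_left hq, hg.diag]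
        simpa using hpos
  calc _ = ‖(dyadicSum hT g n t - dyadicSum hT g n s
        - ∑ j ∈ Finset.range (2 ^ n), g (τ j) (τ (j + 1)))
        + (∑ j ∈ Finset.range (2 ^ n), g (τ j) (τ (j + 1)) - g s t)‖ := by congr 1; abel
    _ ≤ _ := (norm_add_le _ _).trans (add_le_add hlocal hmax)

/-- The sewing lemma. -/
theorem AlmostAdditive.exists_sewing [CompleteSpace E] {θ K : ℝ} {g : I T → I T → E}
    (hT : 0 ≤ T) (hg : AlmostAdditive θ K g) :
    ∃ X : I T → E, (∀ t : I T, (t : ℝ) = 0 → X t = 0) ∧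
      ∀ s t : I T, s ≤ t → ‖X t - X s - g s t‖ ≤ sewConst θ * K * ((t : ℝ) - s) ^ θ := by
  have hr := two_rpow_one_sub_lt_one hg.one_lt
  have hr0 : (0 : ℝ) ≤ 2 ^ (1 - θ) := Real.rpow_nonneg two_pos.le _
  choose X hX using fun t => cauchySeq_tendsto_of_complete
    (cauchySeq_of_le_geometric _ _ hr (hg.dist_dyadicSum_succ hT t))
  refine ⟨X, fun t ht => ?_, fun s t hst => ?_⟩
  · refine tendsto_nhds_unique (hX t) ?_
    have : ∀ n, dyadicSum hT g n t = 0 := fun n => Finset.sum_eq_zero fun j _ => by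
      have h : ∀ u : I T, t ≤ u := fun u => by
        rw [← Subtype.coe_le_coe, ht]
        exact u.2.1
      rw [min_eq_left (h _), min_eq_left (h _), hg.diag]
    simp only [this]
    exact tendsto_const_nhds
  · have hlim : Tendsto (fun n : ℕ => K * T ^ θ * ((2 : ℝ) ^ (1 - θ)) ^ n
        + sewConst θ * K * ((t : ℝ) - s) ^ θ) atTop
        (𝓝 (sewConst θ * K * ((t : ℝ) - s) ^ θ)) := by
      simpa using ((tendsto_pow_atTop_nhds_zero_of_lt_one hr0 hr).const_mul
        (K * T ^ θ)).add_const (sewConst θ * K * ((t : ℝ) - s) ^ θ)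
    exact le_of_tendsto_of_tendsto' (((hX t).sub (hX s)).sub_const _).norm hlim
      (hg.norm_dyadicSum_sub_le hT hst)

/-- Terms of order `|τ_{i+1} - τ_i|^θ`, `θ > 1`, are negligible in Riemann sums. -/
theorem IsPartition.norm_sum_le {θ C δ : ℝ} (hθ : 1 < θ) (hC : 0 ≤ C) (hδ : 0 < δ) {s t : I T} {n : ℕ}
    {τ : ℕ → I T} (hτ : IsPartition s t δ n τ) {f : ℕ → E}
    (hf : ∀ i < n, ‖f i‖ ≤ C * ((τ (i + 1) : ℝ) - τ i) ^ θ) :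
    ‖∑ i ∈ Finset.range n, f i‖ ≤ C * δ ^ (θ - 1) * T := by
  obtain ⟨h0, hn, hstep⟩ := hτ
  have hterm : ∀ i ∈ Finset.range n,
      ‖f i‖ ≤ C * δ ^ (θ - 1) * ((τ (i + 1) : ℝ) - τ i) := fun i hi => by
    have hi := Finset.mem_range.1 hi
    have h := rpow_le_rpow_mul_rpow (coe_sub_pos (hstep i hi).1) (hstep i hi).2.le hθ.le
    rw [Real.rpow_one] at h
    exact (hf i hi).trans ((mul_le_mul_of_nonneg_left h hC).trans_eq (mul_assoc _ _ _).symm)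
  refine (norm_sum_le_of_le _ hterm).trans ?_
  rw [← Finset.mul_sum, Finset.sum_range_sub (fun i => (τ i : ℝ)), h0, hn]
  exact mul_le_mul_of_nonneg_left (coe_sub_le s t) (mul_nonneg hC (Real.rpow_nonneg hδ.le _))

theorem exists_mul_rpow_lt {η ε : ℝ} (C : ℝ) (hη : 0 < η) (hε : 0 < ε) :
    ∃ δ > 0, ∀ h, 0 ≤ h → h ≤ δ → C * h ^ η < ε := by
  have hc : Continuous fun h : ℝ => C * h ^ η :=
    continuous_const.mul (continuous_id.rpow_const fun _ => Or.inr hη.le)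
  have h0 := hc.tendsto 0
  simp only [Real.zero_rpow hη.ne', mul_zero] at h0
  obtain ⟨δ, hδ, hb⟩ := Metric.eventually_nhds_iff.1 (h0.eventually_lt_const hε)
  refine ⟨δ / 2, half_pos hδ, fun h h1 h2 => hb ?_⟩
  rw [Real.dist_eq, sub_zero, abs_of_nonneg h1]
  linarith

/-- The increments of `X` telescope over any partition, so the error of a Riemann sum is a sum of
local errors of order `θ > 1`. This passes from the dyadic construction to limits over all
partitions. -/
theorem hasSewing_of_bound {θ C : ℝ} (hθ : 1 < θ) (hC : 0 ≤ C) {X : I T → E}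
    {g : I T → I T → E}
    (h : ∀ s t : I T, s < t → ‖X t - X s - g s t‖ ≤ C * ((t : ℝ) - s) ^ θ) (s t : I T) :
    HasSewing g s t (X t - X s) := by
  intro ε hε
  obtain ⟨δ, hδ, hsmall⟩ := exists_mul_rpow_lt (C * T) (sub_pos.2 hθ) hε
  refine ⟨δ, hδ, fun n τ hτ => ?_⟩
  have e : ∑ i ∈ Finset.range n, g (τ i) (τ (i + 1)) - (X t - X s)
      = ∑ i ∈ Finset.range n, (g (τ i) (τ (i + 1)) - (X (τ (i + 1)) - X (τ i))) := by
    rw [Finset.sum_sub_distrib, Finset.sum_range_sub (fun i => X (τ i)), hτ.1, hτ.2.1]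
  rw [e]
  refine (hτ.norm_sum_le hθ hC hδ fun i hi => ?_).trans_lt ?_
  · rw [norm_sub_rev]
    exact h _ _ (hτ.2.2 i hi).1
  · have := hsmall δ hδ.le le_rfl
    linarith

end Sewing

/-! ### Two-parameter functions of order `|t-s|^ζ` -/

section HBound

variable {T : ℝ} {E : Type*} [NormedAddCommGroup E]

/-- `‖g_{st}‖ ≤ C |t-s|^ζ` for some constant `C`. -/
def HBound (ζ : ℝ) (g : I T → I T → E) : Prop :=
  ∃ C : ℝ, 0 ≤ C ∧ ∀ s t : I T, s < t → ‖g s t‖ ≤ C * ((t : ℝ) - s) ^ ζ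

namespace HBound

theorem congr {ζ : ℝ} {f g : I T → I T → E} (hf : HBound ζ f)
    (h : ∀ s t : I T, s < t → g s t = f s t) : HBound ζ g := by
  obtain ⟨C, hC, hb⟩ := hf
  exact ⟨C, hC, fun s t hst => by rw [h s t hst]; exact hb s t hst⟩

theorem add {ζ : ℝ} {f g : I T → I T → E} (hf : HBound ζ f) (hg : HBound ζ g) :
    HBound ζ fun s t => f s t + g s t := by
  obtain ⟨C, hC, hf⟩ := hf
  obtain ⟨D, hD, hg⟩ := hg
  exact ⟨C + D, add_nonneg hC hD, fun s t hst =>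
    (norm_add_le_of_le (hf s t hst) (hg s t hst)).trans_eq (add_mul _ _ _).symm⟩

theorem neg {ζ : ℝ} {f : I T → I T → E} (hf : HBound ζ f) : HBound ζ fun s t => -f s t := by
  obtain ⟨C, hC, hf⟩ := hf
  exact ⟨C, hC, fun s t hst => by rw [norm_neg]; exact hf s t hst⟩

theorem sub {ζ : ℝ} {f g : I T → I T → E} (hf : HBound ζ f) (hg : HBound ζ g) :
    HBound ζ fun s t => f s t - g s t :=
  (hf.add hg.neg).congr fun _ _ _ => sub_eq_add_neg _ _

theorem zero (ζ : ℝ) : HBound ζ fun _ _ : I T => (0 : E) :=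
  ⟨0, le_rfl, fun s t _ => by simp⟩

theorem sum {ζ : ℝ} {ι : Type*} (S : Finset ι) {f : ι → I T → I T → E}
    (hf : ∀ i, HBound ζ (f i)) : HBound ζ fun s t => ∑ i ∈ S, f i s t := by
  classical
  induction S using Finset.induction_on with
  | empty => exact (zero ζ).congr fun _ _ _ => Finset.sum_empty
  | insert a S ha ih => exact ((hf a).add ih).congr fun _ _ _ => Finset.sum_insert ha

theorem mono {ζ ξ : ℝ} (hξ : ξ ≤ ζ) {f : I T → I T → E} (hf : HBound ζ f) : HBound ξ f := by
  obtain ⟨C, hC, hf⟩ := hf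
  rcases le_or_gt 0 T with hT | hT
  · refine ⟨C * T ^ (ζ - ξ), mul_nonneg hC (Real.rpow_nonneg hT _), fun s t hst =>
      (hf s t hst).trans ?_⟩
    rw [mul_assoc]
    exact mul_le_mul_of_nonneg_left
      (rpow_le_rpow_mul_rpow (coe_sub_pos hst) (coe_sub_le s t) hξ) hC
  -- For `T < 0` the time interval is empty.
  · exact ⟨0, le_rfl, fun s _ _ => absurd (s.2.1.trans s.2.2) hT.not_ge⟩

/-- A bounded factor counts as order `0`, so that it fits into products where orders add. -/
theorem left {f : I T → E} {A : ℝ} (h : ∀ t, ‖f t‖ ≤ A) : HBound 0 fun s _ : I T => f s :=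
  ⟨|A|, abs_nonneg A, fun s t _ => by
    rw [Real.rpow_zero, mul_one]
    exact (h s).trans (le_abs_self A)⟩

theorem right {f : I T → E} {A : ℝ} (h : ∀ t, ‖f t‖ ≤ A) : HBound 0 fun _ t : I T => f t :=
  ⟨|A|, abs_nonneg A, fun s t _ => by
    rw [Real.rpow_zero, mul_one]
    exact (h t).trans (le_abs_self A)⟩

theorem mul_bound {ζ ξ : ℝ} {F G H : Type*} [NormedAddCommGroup F] [NormedAddCommGroup G]
    [NormedAddCommGroup H] {f : I T → I T → F} {g : I T → I T → G} {k : I T → I T → H}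
    (hf : HBound ζ f) (hg : HBound ξ g) (h : ∀ s t, ‖k s t‖ ≤ ‖f s t‖ * ‖g s t‖) :
    HBound (ζ + ξ) k := by
  obtain ⟨C, hC, hf⟩ := hf
  obtain ⟨D, hD, hg⟩ := hg
  refine ⟨C * D, mul_nonneg hC hD, fun s t hst => (h s t).trans ?_⟩
  calc _ ≤ (C * ((t : ℝ) - s) ^ ζ) * (D * ((t : ℝ) - s) ^ ξ) :=
        mul_le_mul (hf s t hst) (hg s t hst) (norm_nonneg _)
          (mul_nonneg hC (Real.rpow_nonneg (coe_sub_nonneg hst.le) _))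
    _ = _ := by rw [Real.rpow_add (coe_sub_pos hst)]; ring

variable [NormedSpace ℝ E]

theorem smul {ζ ξ : ℝ} {c : I T → I T → ℝ} {g : I T → I T → E} (hc : HBound ζ c)
    (hg : HBound ξ g) : HBound (ζ + ξ) fun s t => c s t • g s t :=
  hc.mul_bound hg fun _ _ => norm_smul_le _ _

theorem const_smul {ζ : ℝ} (c : ℝ) {g : I T → I T → E} (hg : HBound ζ g) :
    HBound ζ fun s t => c • g s t := by
  have h := (left (T := T) (f := fun _ => c) (fun _ => le_rfl)).smul hg
  rwa [zero_add] at h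

theorem tmul {ζ ξ : ℝ} {f g : I T → I T → E} (hf : HBound ζ f) (hg : HBound ξ g) :
    HBound (ζ + ξ) fun s t => tmul (f s t) (g s t) :=
  hf.mul_bound hg fun _ _ => norm_tmul_le _ _

omit [NormedSpace ℝ E] in
theorem exists_norm_le {ζ : ℝ} (hζ : 0 < ζ) {f : I T → E} (h : HBound ζ (incr f)) :
    ∃ A : ℝ, ∀ t, ‖f t‖ ≤ A := by
  obtain ⟨C, -, h⟩ := h
  exact exists_norm_le_of_bound hζ h

/-- The product of Hoelder paths is Hoelder. -/
theorem incr_tmul {ζ : ℝ} (hζ : 0 < ζ) {f g : I T → E} (hf : HBound ζ (incr f))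
    (hg : HBound ζ (incr g)) : HBound ζ (incr fun t => RoughMV.tmul (f t) (g t)) := by
  obtain ⟨A, hA⟩ := hf.exists_norm_le hζ
  obtain ⟨B, hB⟩ := hg.exists_norm_le hζ
  have h1 := hf.tmul (right hB)
  have h2 := (left hA).tmul hg
  rw [add_zero] at h1
  rw [zero_add] at h2
  refine (h1.add h2).congr fun s t _ => ?_
  simp only [incr, sub_tmul, tmul_sub]
  abel

end HBound

end HBound

/-! ### Rough integration of controlled paths -/

section RoughIntegral

variable {T : ℝ} {m : ℕ} {F : Type*} [NormedAddCommGroup F] [NormedSpace ℝ F]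

/-- The coordinates of an `α`-Hoelder rough path in `ℝ^m`. -/
structure IsRoughCoord (α : ℝ) (Z : I T → Rd m) (W : I T → I T → Fin m → Fin m → ℝ) : Prop where
  path : ∀ i, HBound α fun s t => Z t i - Z s i
  area : ∀ l i, HBound (2 * α) fun s t => W s t l i
  chen : ∀ s u t : I T, s < u → u < t → ∀ l i,
    W s t l i = W u t l i + W s u l i + (Z u l - Z s l) * (Z t i - Z u i)

theorem IsRoughCoord.mono {α β : ℝ} {Z : I T → Rd m} {W : I T → I T → Fin m → Fin m → ℝ}
    (h : IsRoughCoord β Z W) (hα : α ≤ β) : IsRoughCoord α Z W :=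
  ⟨fun i => (h.path i).mono hα, fun l i => (h.area l i).mono (by linarith), h.chen⟩

theorem IsRoughPath.isRoughCoord {α : ℝ} {Z : I T → Rd m} {ZZ : I T → I T → PT (Rd m)}
    (h : IsRoughPath α Z ZZ) : IsRoughCoord α Z fun s t l i => ptCoord l i (ZZ s t) := by
  refine ⟨fun i => ?_, fun l i => ?_, fun s u t hsu hut l i => ?_⟩
  · obtain ⟨C, hC, hb⟩ := exists_bound_of_hoelder_lt_top h.path.2
    exact ⟨C, hC, fun s t hst => (PiLp.norm_apply_le (incr Z s t) i).trans (hb s t hst)⟩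
  · obtain ⟨C, hC, hb⟩ := exists_bound_of_hoelder_lt_top h.area.2
    refine ⟨‖(ptCoord l i : PT (Rd m) →L[ℝ] ℝ)‖ * C, by positivity, fun s t hst => ?_⟩
    rw [mul_assoc]
    exact ContinuousLinearMap.le_opNorm_of_le _ (hb s t hst)
  · have e := congrArg (ptCoord l i) (h.chen s u t hsu hut)
    rw [map_sub, map_sub, ptCoord_tmul] at e
    simp only [PiLp.sub_apply] at e
    linarith

/-- Weak geometricity in coordinates, where the flip exchanges the two indices. -/
theorem IsWeaklyGeometric.coord_add_coord {α : ℝ} {Z : I T → Rd m} {ZZ : I T → I T → PT (Rd m)}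
    (h : IsWeaklyGeometric α Z ZZ) {s t : I T} (hst : s < t) (l i : Fin m) :
    ptCoord l i (ZZ s t) + ptCoord i l (ZZ s t) = (Z t l - Z s l) * (Z t i - Z s i) := by
  have e := congrArg (ptCoord l i) (h.sym s t hst)
  rw [ptSym, map_smul, map_add, ptCoord_ptSwap, map_smul, ptCoord_tmul] at e
  simp only [PiLp.sub_apply, smul_eq_mul] at e
  linarith

/-- The bounds satisfied by a controlled path with values in `L(ℝ^m;F)`. -/
structure IsControlledCoord (α : ℝ) (Z : I T → Rd m) (Y : I T → Fin m → F)
    (Y' : I T → Fin m → Fin m → F) : Prop where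
  deriv : ∀ i l, HBound α (incr fun t => Y' t i l)
  remainder : ∀ i, HBound (2 * α) fun s t => Y t i - Y s i - ∑ l, (Z t l - Z s l) • Y' s i l

theorem IsControlled.isControlledCoord {α : ℝ} {Z : I T → Rd m} {Y : I T → Fin m → F}
    {Y' : I T → Fin m → Fin m → F}
    (h : ∀ i, IsControlled α Z (fun t => Y t i) fun t l => Y' t i l) :
    IsControlledCoord α Z Y Y' :=
  ⟨fun i l => exists_bound_of_hoelder_lt_top ((h i).deriv l).2,
    fun i => exists_bound_of_hoelder_lt_top (h i).remainder.2⟩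

/-- The increment is the remainder, of order `2α`, plus a bounded derivative applied to the
increment of `Z`. -/
theorem IsControlledCoord.incr_path {α : ℝ} (hα : 0 < α) {Z : I T → Rd m}
    {W : I T → I T → Fin m → Fin m → ℝ} (hZ : IsRoughCoord α Z W) {Y : I T → Fin m → F}
    {Y' : I T → Fin m → Fin m → F} (h : IsControlledCoord α Z Y Y') (i : Fin m) :
    HBound α (incr fun t => Y t i) := by
  have h1 : HBound α fun s t : I T => ∑ l, (Z t l - Z s l) • Y' s i l := HBound.sum _ fun l => by
    obtain ⟨A, hA⟩ := (h.deriv i l).exists_norm_le hα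
    have := (hZ.path l).smul (HBound.left hA)
    rwa [add_zero] at this
  refine (((h.remainder i).mono (by linarith)).add h1).congr fun s t _ => ?_
  simp only [incr, sub_add_cancel]

/-- The local expansion `Y_s^i Z_{st}^i + Y_s^{i,l} W_{st}^{l,i}` of a rough integral. -/
def localExp (Z : I T → Rd m) (W : I T → I T → Fin m → Fin m → ℝ) (Y : I T → Fin m → F)
    (Y' : I T → Fin m → Fin m → F) (s t : I T) : F :=
  ∑ i, (Z t i - Z s i) • Y s i + ∑ i, ∑ l, W s t l i • Y' s i l

/-- The product term in Chen's relation cancels the first-order part of the increment of `Y`. What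
is left has products of orders `α + 2α` and `2α + α`, hence total order `3α`. -/
theorem IsRoughCoord.localExp_defect {α : ℝ} {Z : I T → Rd m}
    {W : I T → I T → Fin m → Fin m → ℝ} (hZ : IsRoughCoord α Z W) (Y : I T → Fin m → F)
    (Y' : I T → Fin m → Fin m → F) {s u t : I T} (hsu : s < u) (hut : u < t) :
    localExp Z W Y Y' s t - localExp Z W Y Y' s u - localExp Z W Y Y' u t
      = -(∑ i, (Z t i - Z u i) • (Y u i - Y s i - ∑ l, (Z u l - Z s l) • Y' s i l)
          + ∑ i, ∑ l, W u t l i • (Y' u i l - Y' s i l)) := by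
  have key : ∀ i, ∑ l, W s t l i • Y' s i l - ∑ l, W s u l i • Y' s i l - ∑ l, W u t l i • Y' u i l
      = (Z t i - Z u i) • (∑ l, (Z u l - Z s l) • Y' s i l)
        - ∑ l, W u t l i • (Y' u i l - Y' s i l) := fun i => by
    rw [Finset.smul_sum, ← Finset.sum_sub_distrib, ← Finset.sum_sub_distrib,
      ← Finset.sum_sub_distrib]
    refine Finset.sum_congr rfl fun l _ => ?_
    rw [hZ.chen s u t hsu hut l i]
    module
  simp only [localExp, ← Finset.sum_add_distrib, ← Finset.sum_sub_distrib,
    ← Finset.sum_neg_distrib]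
  refine Finset.sum_congr rfl fun i _ => ?_
  have e : ∀ a b c p q r : F, a + p - (b + q) - (c + r) = a - b - c + (p - q - r) := by
    intros; abel
  rw [e, key]
  module

/-- Existence of the rough integral of a controlled path, with the error estimate for the local
expansion. -/
theorem IsRoughCoord.exists_integral [CompleteSpace F] (hT : 0 ≤ T) {α : ℝ} (hα : 1 < 3 * α)
    {Z : I T → Rd m} {W : I T → I T → Fin m → Fin m → ℝ} (hZ : IsRoughCoord α Z W)
    {Y : I T → Fin m → F} {Y' : I T → Fin m → Fin m → F} (hY : IsControlledCoord α Z Y Y') :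
    ∃ X : I T → F, (∀ t : I T, (t : ℝ) = 0 → X t = 0) ∧
      HBound (3 * α) (fun s t => X t - X s - localExp Z W Y Y' s t) ∧
      ∀ s t, HasSewing (localExp Z W Y Y') s t (X t - X s) := by
  choose A hA hA' using hZ.path
  choose B hB hB' using hZ.area
  choose C hC hC' using hY.remainder
  choose D hD hD' using hY.deriv
  -- One summand for each product in the formula for the defect.
  set K : ℝ := ∑ i, A i * C i + ∑ i, ∑ l, B l i * D i l with hKdef
  have hK : 0 ≤ K := add_nonneg (Finset.sum_nonneg fun i _ => mul_nonneg (hA i) (hC i))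
    (Finset.sum_nonneg fun i _ => Finset.sum_nonneg fun l _ => mul_nonneg (hB l i) (hD i l))
  have hdefect : ∀ s u t : I T, s < u → u < t →
      ‖localExp Z W Y Y' s t - localExp Z W Y Y' s u - localExp Z W Y Y' u t‖
        ≤ K * ((t : ℝ) - s) ^ (3 * α) := by
    intro s u t hsu hut
    have h1 := coe_sub_pos hsu
    have h2 := coe_sub_pos hut
    have h3 : 0 < (t : ℝ) - s := by linarith
    have p1 : ((u : ℝ) - s) ^ α ≤ ((t : ℝ) - s) ^ α :=
      Real.rpow_le_rpow h1.le (by linarith) (by linarith)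
    have p2 : ((u : ℝ) - s) ^ (2 * α) ≤ ((t : ℝ) - s) ^ (2 * α) :=
      Real.rpow_le_rpow h1.le (by linarith) (by linarith)
    have p3 : ((t : ℝ) - u) ^ α ≤ ((t : ℝ) - s) ^ α :=
      Real.rpow_le_rpow h2.le (by linarith) (by linarith)
    have p4 : ((t : ℝ) - u) ^ (2 * α) ≤ ((t : ℝ) - s) ^ (2 * α) :=
      Real.rpow_le_rpow h2.le (by linarith) (by linarith)
    have e : ((t : ℝ) - s) ^ (3 * α) = ((t : ℝ) - s) ^ α * ((t : ℝ) - s) ^ (2 * α) := by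
      rw [← Real.rpow_add h3]; congr 1; ring
    rw [hZ.localExp_defect Y Y' hsu hut, norm_neg, hKdef, add_mul, Finset.sum_mul, Finset.sum_mul]
    refine norm_add_le_of_le (norm_sum_le_of_le _ fun i _ => ?_)
      (norm_sum_le_of_le _ fun i _ => ?_)
    · refine (norm_smul_le _ _).trans ((mul_le_mul ((hA' i u t hut).trans
        (mul_le_mul_of_nonneg_left p3 (hA i))) ((hC' i s u hsu).trans
        (mul_le_mul_of_nonneg_left p2 (hC i))) (norm_nonneg _) ?_).trans_eq ?_)
      · exact mul_nonneg (hA i) (Real.rpow_nonneg h3.le _)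
      · rw [e]; ring
    · rw [Finset.sum_mul]
      refine norm_sum_le_of_le _ fun l _ => (norm_smul_le _ _).trans
        ((mul_le_mul ((hB' l i u t hut).trans
        (mul_le_mul_of_nonneg_left p4 (hB l i))) ((hD' i l s u hsu).trans
        (mul_le_mul_of_nonneg_left p1 (hD i l))) (norm_nonneg _) ?_).trans_eq ?_)
      · exact mul_nonneg (hB l i) (Real.rpow_nonneg h3.le _)
      · rw [e]; ring
  classical
  -- The values of `W` on the diagonal are unconstrained, so the germ is set to `0` there.
  set g : I T → I T → F := fun s t => if s < t then localExp Z W Y Y' s t else 0 with hgdef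
  have hg : AlmostAdditive (3 * α) K g := by
    refine ⟨hα, hK, fun s => if_neg (lt_irrefl s), fun s u t hsu hut => ?_⟩
    have hpos : 0 ≤ K * ((t : ℝ) - s) ^ (3 * α) :=
      mul_nonneg hK (Real.rpow_nonneg (coe_sub_nonneg (hsu.trans hut)) _)
    have h0 : ∀ r, g r r = 0 := fun r => if_neg (lt_irrefl r)
    rcases hsu.eq_or_lt with rfl | hsu
    · simpa [h0] using hpos
    rcases hut.eq_or_lt with rfl | hut
    · simpa [h0] using hpos
    simp only [hgdef, if_pos hsu, if_pos hut, if_pos (hsu.trans hut)]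
    exact hdefect s u t hsu hut
  obtain ⟨X, hX0, hX⟩ := hg.exists_sewing hT
  have hC : 0 ≤ sewConst (3 * α) * K := mul_nonneg (sewConst_pos hα).le hK
  have hX' : ∀ s t : I T, s < t → ‖X t - X s - localExp Z W Y Y' s t‖
      ≤ sewConst (3 * α) * K * ((t : ℝ) - s) ^ (3 * α) := fun s t hst => by
    have := hX s t hst.le
    simpa only [hgdef, if_pos hst] using this
  exact ⟨X, hX0, ⟨_, hC, hX'⟩, hasSewing_of_bound hα hC hX'⟩

variable {α β : ℝ} {Z : I T → Rd m} {W : I T → I T → Fin m → Fin m → ℝ}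
  {Y : I T → Fin m → F} {Y' : I T → Fin m → Fin m → F} {X : I T → F}

/-- The first order expansion of a rough integral. -/
theorem IsControlledCoord.integral_remainder (hα : 0 < α)
    (hZ : IsRoughCoord α Z W) (hY : IsControlledCoord α Z Y Y')
    (hX : HBound (3 * α) fun s t => X t - X s - localExp Z W Y Y' s t) :
    HBound (2 * α) fun s t => X t - X s - ∑ i, (Z t i - Z s i) • Y s i := by
  have h1 : HBound (2 * α) fun s t : I T => ∑ i, ∑ l, W s t l i • Y' s i l :=
    HBound.sum _ fun i => HBound.sum _ fun l => by
      obtain ⟨A, hA⟩ := (hY.deriv i l).exists_norm_le hα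
      have := (hZ.area l i).smul (HBound.left hA)
      rwa [add_zero] at this
  refine ((hX.mono (by linarith)).add h1).congr fun s t _ => ?_
  simp only [localExp]
  abel

/-- The exponent `α` only serves to bound `Y`; the order comes from the better exponent `β` of the
increments of `Z`. -/
theorem IsControlledCoord.sum_smul_bound (hα : 0 < α) (hZα : IsRoughCoord α Z W)
    (hZ : IsRoughCoord β Z W) (hY : IsControlledCoord α Z Y Y') :
    HBound β fun s t => ∑ i, (Z t i - Z s i) • Y s i :=
  HBound.sum _ fun i => by
    obtain ⟨A, hA⟩ := (hY.incr_path hα hZα i).exists_norm_le hα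
    have := (hZ.path i).smul (HBound.left hA)
    rwa [add_zero] at this

/-- A rough integral inherits the Hoelder exponent of the integrator, up to `2 α`. -/
theorem IsControlledCoord.integral_incr (hα : 0 < α) (hβ : β ≤ 2 * α)
    (hZα : IsRoughCoord α Z W) (hZ : IsRoughCoord β Z W) (hY : IsControlledCoord α Z Y Y')
    (hX : HBound (3 * α) fun s t => X t - X s - localExp Z W Y Y' s t) :
    HBound β (incr X) :=
  (((hY.integral_remainder hα hZα hX).mono hβ).add (hY.sum_smul_bound hα hZα hZ)).congr
    fun s t _ => by simp only [incr, sub_add_cancel]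

/-- The integrand `X ⊗ Y`, with derivative `Y^l ⊗ Y^i + X ⊗ Y^{i,l}`, of the iterated integral is
controlled. -/
theorem IsControlledCoord.tmul_integral (hα : 0 < α)
    (hZ : IsRoughCoord α Z W) (hY : IsControlledCoord α Z Y Y')
    (hX : HBound (3 * α) fun s t => X t - X s - localExp Z W Y Y' s t) :
    IsControlledCoord α Z (fun t i => tmul (X t) (Y t i))
      (fun t i l => tmul (Y t l) (Y t i) + tmul (X t) (Y' t i l)) := by
  have hXi := hY.integral_incr hα (by linarith) hZ hZ hX
  have hYi := fun i => hY.incr_path hα hZ i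
  refine ⟨fun i l => ?_, fun i => ?_⟩
  · refine ((HBound.incr_tmul hα (hYi l) (hYi i)).add
      (HBound.incr_tmul hα hXi (hY.deriv i l))).congr fun s t _ => ?_
    simp only [incr]
    abel
  · obtain ⟨A, hA⟩ := (hYi i).exists_norm_le hα
    obtain ⟨B, hB⟩ := hXi.exists_norm_le hα
    -- Product rule: the remainder of `X ⊗ Y` is the remainder of `X` tensor `Y_s`, plus `X_s`
    -- tensor the remainder of `Y`, plus the product of the two increments.
    have h1 := (hY.integral_remainder hα hZ hX).tmul (HBound.left hA)
    have h2 := (HBound.left hB).tmul (hY.remainder i)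
    have h3 := hXi.tmul (hYi i)
    rw [add_zero] at h1
    rw [zero_add] at h2
    rw [← two_mul] at h3
    refine ((h1.add h2).add h3).congr fun s t _ => ?_
    simp only [incr, sub_tmul, tmul_sub, sum_tmul, tmul_sum, smul_tmul, tmul_smul, smul_add,
      Finset.sum_add_distrib]
    abel

/-- The second level of the lift of `X` determined by `J = ∫ X ⊗ dX`. -/
def areaOf (X : I T → F) (J : I T → PT F) (s t : I T) : PT F :=
  J t - J s - tmul (X s) (X t - X s)

/-- Purely algebraic: it needs neither regularity of `X` and `J` nor any order of the times. -/
theorem areaOf_chen (X : I T → F) (J : I T → PT F) (s u t : I T) :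
    areaOf X J s t = areaOf X J s u + areaOf X J u t + tmul (X u - X s) (X t - X u) := by
  simp only [areaOf, tmul_sub, sub_tmul]
  abel

theorem areaOf_self (X : I T → F) (J : I T → PT F) (s : I T) : areaOf X J s s = 0 := by
  simp [areaOf, tmul_zero]

/-- Subtracting `X_s` tensor the expansion of `X_{st}` from the expansion of `J_{st}` removes every
term containing `X_s`. -/
theorem IsControlledCoord.areaOf_expansion (hα : 0 < α) (hZ : IsRoughCoord α Z W)
    (hY : IsControlledCoord α Z Y Y')
    (hX : HBound (3 * α) fun s t => X t - X s - localExp Z W Y Y' s t) {J : I T → PT F}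
    (hJ : HBound (3 * α) fun s t => J t - J s - localExp Z W (fun t i => tmul (X t) (Y t i))
      (fun t i l => tmul (Y t l) (Y t i) + tmul (X t) (Y' t i l)) s t) :
    HBound (3 * α) fun s t =>
      areaOf X J s t - ∑ i, ∑ l, W s t l i • tmul (Y s l) (Y s i) := by
  obtain ⟨B, hB⟩ := (hY.integral_incr hα (by linarith) hZ hZ hX).exists_norm_le hα
  have h1 := (HBound.left hB).tmul hX
  rw [zero_add] at h1
  refine (hJ.sub h1).congr fun s t _ => ?_
  simp only [areaOf, localExp, tmul_sub, tmul_add, tmul_sum, tmul_smul, smul_add,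
    Finset.sum_add_distrib]
  abel

/-- The leading term inherits the order `2β` of `W`; the remainder does no harm because `2β ≤ 3α`.
-/
theorem IsControlledCoord.areaOf_bound (hα : 0 < α) (hβ : 2 * β ≤ 3 * α)
    (hZα : IsRoughCoord α Z W) (hZ : IsRoughCoord β Z W) (hY : IsControlledCoord α Z Y Y')
    {J : I T → PT F} (hJ : HBound (3 * α) fun s t =>
      areaOf X J s t - ∑ i, ∑ l, W s t l i • tmul (Y s l) (Y s i)) :
    HBound (2 * β) (areaOf X J) := by
  have h1 : HBound (2 * β) fun s t : I T => ∑ i, ∑ l, W s t l i • tmul (Y s l) (Y s i) :=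
    HBound.sum _ fun i => HBound.sum _ fun l => by
      obtain ⟨A, hA⟩ := (hY.incr_path hα hZα i).exists_norm_le hα
      obtain ⟨B, hB⟩ := (hY.incr_path hα hZα l).exists_norm_le hα
      have := (hZ.area l i).smul ((HBound.left hB).tmul (HBound.left hA))
      rwa [add_zero, add_zero] at this
  exact ((hJ.mono hβ).add h1).congr fun s t _ => by simp only [sub_add_cancel]

/-- If the integrator is weakly geometric, then the second level of a rough integral is, up to
negligible terms, the sum of `½ X_{st} ⊗ X_{st}` and of an explicit antisymmetric tensor. -/
theorem IsControlledCoord.areaOf_antisymm (hα : 0 < α)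
    (hZ : IsRoughCoord α Z W) (hsym : ∀ s t : I T, s < t → ∀ l i,
      W s t l i + W s t i l = (Z t l - Z s l) * (Z t i - Z s i))
    (hY : IsControlledCoord α Z Y Y')
    (hX : HBound (3 * α) fun s t => X t - X s - localExp Z W Y Y' s t) {J : I T → PT F}
    (hJ : HBound (3 * α) fun s t =>
      areaOf X J s t - ∑ i, ∑ l, W s t l i • tmul (Y s l) (Y s i)) :
    HBound (3 * α) fun s t => areaOf X J s t - (1 / 2 : ℝ) • tmul (X t - X s) (X t - X s)
      - ∑ i, ∑ l, (W s t l i / 2) • (tmul (Y s l) (Y s i) - tmul (Y s i) (Y s l)) := by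
  have hV := hY.sum_smul_bound hα hZ hZ
  have hXi := hY.integral_incr hα (by linarith) hZ hZ hX
  have hR := hY.integral_remainder hα hZ hX
  -- With `V = ∑ Z^i_{st} Y^i_s` and `R = X_{st} - V`, one has `X_{st} ⊗ X_{st} - V ⊗ V = R ⊗ V +
  -- X_{st} ⊗ R`.
  have h1 := (hR.tmul hV).add ((hXi.tmul hR).mono (ξ := 2 * α + α) (by linarith))
  rw [show 2 * α + α = 3 * α by ring] at h1
  refine (hJ.sub (h1.const_smul (1 / 2))).congr fun s t hst => ?_
  have hVV : tmul (∑ i, (Z t i - Z s i) • Y s i) (∑ i, (Z t i - Z s i) • Y s i)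
      = ∑ i, ∑ l, (W s t l i + W s t i l) • tmul (Y s l) (Y s i) := by
    rw [tmul_sum]
    refine Finset.sum_congr rfl fun i _ => ?_
    rw [sum_tmul]
    refine Finset.sum_congr rfl fun l _ => ?_
    rw [hsym s t hst, smul_tmul, tmul_smul, smul_smul]
  have hswap : ∑ i, ∑ l, (W s t l i / 2) • tmul (Y s i) (Y s l)
      = ∑ i, ∑ l, (W s t i l / 2) • tmul (Y s l) (Y s i) := Finset.sum_comm
  -- By `hVV`, `½ V ⊗ V` is the part with symmetrized coefficients, so subtracting it leaves the
  -- antisymmetric part.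
  have hanti : ∑ i, ∑ l, (W s t l i / 2) • (tmul (Y s l) (Y s i) - tmul (Y s i) (Y s l))
      = ∑ i, ∑ l, W s t l i • tmul (Y s l) (Y s i) - (1 / 2 : ℝ) •
        tmul (∑ i, (Z t i - Z s i) • Y s i) (∑ i, (Z t i - Z s i) • Y s i) := by
    rw [hVV]
    simp only [smul_sub, Finset.sum_sub_distrib, hswap, Finset.smul_sum]
    simp only [← Finset.sum_sub_distrib]
    refine Finset.sum_congr rfl fun i _ => Finset.sum_congr rfl fun l _ => ?_
    module
  rw [hanti]
  simp only [incr]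
  set V := ∑ i, (Z t i - Z s i) • Y s i
  set P := X t - X s
  simp only [sub_tmul, tmul_sub, smul_sub, smul_add]
  abel

end RoughIntegral

/-! ### The canonical lift of a Lipschitz path -/

section LipschitzLift

variable {T : ℝ} {E : Type*} [NormedAddCommGroup E] [NormedSpace ℝ E]

/-- Continuity of the second level follows from that of `J`, whose increment is the area plus `X_s ⊗
X_{st}` and hence of order `α`. -/
theorem isRoughPath_areaOf {α : ℝ} (hα : 0 < α) {X : I T → E} {J : I T → PT E}
    (hX : HBound α (incr X)) (hXX : HBound (2 * α) (areaOf X J)) :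
    IsRoughPath α X (areaOf X J) := by
  obtain ⟨A, hA⟩ := hX.exists_norm_le hα
  have hJ : HBound α (incr J) := by
    have h := (HBound.left hA).tmul hX
    rw [zero_add] at h
    refine ((hXX.mono (by linarith)).add h).congr fun s t _ => ?_
    simp only [areaOf, incr]
    abel
  have hXc : Continuous X := by
    obtain ⟨C, -, h⟩ := hX
    exact continuous_of_bound hα h
  have hJc : Continuous J := by
    obtain ⟨C, -, h⟩ := hJ
    exact continuous_of_bound hα h
  obtain ⟨C, -, hC⟩ := hX
  obtain ⟨D, -, hD⟩ := hXX
  refine ⟨memC_of_bound hα hC, ⟨?_, (hoelder_le hD).trans_lt ENNReal.ofReal_lt_top⟩,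
    fun s u t _ _ => by rw [areaOf_chen X J s u t]; abel⟩
  exact (((hJc.comp continuous_snd).sub (hJc.comp continuous_fst)).sub
    (continuous_tmul (hXc.comp continuous_fst)
      ((hXc.comp continuous_snd).sub (hXc.comp continuous_fst)))).continuousOn

/-- `‖x_t - x_s‖ ≤ L |t-s|`. -/
def LipBound (L : ℝ) (x : I T → E) : Prop :=
  0 ≤ L ∧ ∀ s t : I T, s ≤ t → ‖x t - x s‖ ≤ L * ((t : ℝ) - s)

/-- `‖xx_{st}‖ ≤ C |t-s|^2` for the second level `xx` determined by `K = ∫ x ⊗ dx`. -/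
def AreaBound (C : ℝ) (x : I T → E) (K : I T → PT E) : Prop :=
  0 ≤ C ∧ ∀ s t : I T, s ≤ t → ‖areaOf x K s t‖ ≤ C * ((t : ℝ) - s) ^ 2

/-- The germ `x_s ⊗ x_{st}` has defect `-x_{su} ⊗ x_{ut}`, of order `2`. Sewing takes place in `PT
E`, a completion, so `E` need not be complete. -/
theorem LipBound.exists_area (hT : 0 ≤ T) {L : ℝ} {x : I T → E} (hx : LipBound L x) :
    ∃ K : I T → PT E, AreaBound (sewConst 2 * L ^ 2) x K := by
  have hg : AlmostAdditive 2 (L ^ 2) fun s t => tmul (x s) (x t - x s) := by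
    refine ⟨one_lt_two, sq_nonneg L, fun s => by rw [sub_self, tmul_zero], fun s u t hsu hut => ?_⟩
    have e : tmul (x s) (x t - x s) - tmul (x s) (x u - x s) - tmul (x u) (x t - x u)
        = -tmul (x u - x s) (x t - x u) := by
      simp only [tmul_sub, sub_tmul]
      abel
    have h1 := coe_sub_nonneg hsu
    have h2 := coe_sub_nonneg hut
    rw [e, norm_neg, Real.rpow_two]
    calc _ ≤ ‖x u - x s‖ * ‖x t - x u‖ := norm_tmul_le _ _
      _ ≤ (L * ((t : ℝ) - s)) * (L * ((t : ℝ) - s)) :=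
        mul_le_mul ((hx.2 s u hsu).trans (mul_le_mul_of_nonneg_left (by linarith) hx.1))
          ((hx.2 u t hut).trans (mul_le_mul_of_nonneg_left (by linarith) hx.1)) (norm_nonneg _)
          (mul_nonneg hx.1 (by linarith))
      _ = _ := by ring
  obtain ⟨K, -, hK⟩ := hg.exists_sewing hT
  exact ⟨K, mul_nonneg (sewConst_pos one_lt_two).le (sq_nonneg L),
    fun s t hst => by simpa only [areaOf, Real.rpow_two] using hK s t hst⟩

omit [NormedSpace ℝ E] in
theorem LipBound.boundedVariationOn {L : ℝ} {x : I T → E} (hx : LipBound L x) :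
    BoundedVariationOn x univ := by
  rcases le_or_gt 0 T with hT | hT
  · have hbv : BoundedVariationOn (fun t : I T => (t : ℝ)) univ :=
      MonotoneOn.boundedVariationOn (fun s _ t _ hst => hst)
        (fun t _ => abs_le.2 ⟨by linarith [t.2.1], t.2.2⟩ : ∀ t ∈ (univ : Set (I T)), |(t : ℝ)| ≤ T)
    -- `x` factors as a Lipschitz function on `[0,T]` composed with the inclusion into `ℝ`, which is
    -- monotone and bounded.
    have hL : LipschitzOnWith L.toNNReal (fun r : ℝ => x (projIcc 0 T hT r)) (Icc 0 T) := by
      refine LipschitzOnWith.of_dist_le_mul fun s hs t ht => ?_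
      rw [projIcc_of_mem hT hs, projIcc_of_mem hT ht, Real.coe_toNNReal L hx.1, dist_eq_norm,
        Real.dist_eq]
      rcases le_total s t with hst | hst
      · rw [norm_sub_rev, abs_sub_comm, abs_of_nonneg (sub_nonneg.2 hst)]
        exact hx.2 ⟨s, hs⟩ ⟨t, ht⟩ hst
      · rw [abs_of_nonneg (sub_nonneg.2 hst)]
        exact hx.2 ⟨t, ht⟩ ⟨s, hs⟩ hst
    have h := hL.comp_boundedVariationOn (g := fun t : I T => (t : ℝ)) (s := univ)
      (fun t _ => t.2) hbv
    have e : (fun r : ℝ => x (projIcc 0 T hT r)) ∘ (fun t : I T => (t : ℝ)) = x := by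
      funext t
      simp
    rwa [e] at h
  · have : IsEmpty (I T) := ⟨fun s => absurd (s.2.1.trans s.2.2) hT.not_ge⟩
    simp [BoundedVariationOn, eVariationOn.subsingleton x Set.subsingleton_of_subsingleton]

/-- After telescoping, each cell contributes `(x_{ξ_i} - x_{τ_i}) ⊗ x_{τ_i τ_{i+1}}` minus its own
area, both of order `2`, uniformly in the tags. -/
theorem LipBound.hasRSIntegral {L C : ℝ} {x : I T → E} {K : I T → PT E} (hx : LipBound L x)
    (hK : AreaBound C x K) (s t : I T) :
    HasRSIntegral (fun r => x r - x s) x s t (areaOf x K s t) := by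
  intro ε hε
  have hCL : 0 ≤ L ^ 2 + C := add_nonneg (sq_nonneg L) hK.1
  obtain ⟨δ, hδ, hsmall⟩ := exists_mul_rpow_lt ((L ^ 2 + C) * T) (η := 2 - 1) (by norm_num) hε
  refine ⟨δ, hδ, fun n τ ξ hτ hξ => ?_⟩
  have e : ∑ i ∈ Finset.range n, tmul (x (ξ i) - x s) (x (τ (i + 1)) - x (τ i)) - areaOf x K s t
      = ∑ i ∈ Finset.range n, (tmul (x (ξ i) - x (τ i)) (x (τ (i + 1)) - x (τ i))
        - areaOf x K (τ i) (τ (i + 1))) := by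
    have h1 : ∀ i, tmul (x (ξ i) - x (τ i)) (x (τ (i + 1)) - x (τ i))
        - areaOf x K (τ i) (τ (i + 1))
        = tmul (x (ξ i) - x s) (x (τ (i + 1)) - x (τ i))
          - ((K (τ (i + 1)) - tmul (x s) (x (τ (i + 1)))) - (K (τ i) - tmul (x s) (x (τ i)))) := by
      intro i
      simp only [areaOf, tmul_sub, sub_tmul]
      abel
    simp only [h1]
    rw [Finset.sum_sub_distrib,
      Finset.sum_range_sub (fun i => K (τ i) - tmul (x s) (x (τ i))), hτ.1, hτ.2.1]
    simp only [areaOf, tmul_sub]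
    abel
  rw [e]
  refine (hτ.norm_sum_le (θ := 2) (C := L ^ 2 + C) one_lt_two hCL hδ fun i hi => ?_).trans_lt ?_
  · obtain ⟨h1, h2⟩ := hξ i hi
    have h3 := coe_sub_nonneg h1
    have h4 := coe_sub_nonneg h2
    have h5 := coe_sub_pos (hτ.2.2 i hi).1
    rw [Real.rpow_two, add_mul]
    refine (norm_sub_le _ _).trans (add_le_add ?_ (hK.2 _ _ (hτ.2.2 i hi).1.le))
    calc _ ≤ ‖x (ξ i) - x (τ i)‖ * ‖x (τ (i + 1)) - x (τ i)‖ := norm_tmul_le _ _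
      _ ≤ (L * ((τ (i + 1) : ℝ) - τ i)) * (L * ((τ (i + 1) : ℝ) - τ i)) :=
        mul_le_mul ((hx.2 _ _ h1).trans (mul_le_mul_of_nonneg_left (by linarith) hx.1))
          (hx.2 _ _ (hτ.2.2 i hi).1.le) (norm_nonneg _) (mul_nonneg hx.1 h5.le)
      _ = _ := by ring
  · have := hsmall δ hδ.le le_rfl
    linarith

theorem LipBound.isBVLift {L C α : ℝ} {x : I T → E} {K : I T → PT E} (hx : LipBound L x)
    (hK : AreaBound C x K) (h0 : 0 < α) (h1 : α ≤ 1) : IsBVLift α x (areaOf x K) := by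
  refine ⟨hx.boundedVariationOn, isRoughPath_areaOf h0 ?_ ?_, fun s t _ => hx.hasRSIntegral hK s t⟩
  · exact HBound.mono h1 ⟨L, hx.1, fun s t hst => by rw [Real.rpow_one]; exact hx.2 s t hst.le⟩
  · exact HBound.mono (ζ := 2) (by linarith)
      ⟨C, hK.1, fun s t hst => by rw [Real.rpow_two]; exact hK.2 s t hst.le⟩

/-- The area of a straight segment. -/
theorem AreaBound.areaOf_segment {C : ℝ} {x : I T → E} {K : I T → PT E} (hK : AreaBound C x K)
    {L : ℝ} (hx : LipBound L x) {a b : I T} (hab : a ≤ b) {w : E}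
    (hw : ∀ s t : I T, a ≤ s → s ≤ t → t ≤ b → ∃ c : ℝ, x t - x s = c • w) :
    areaOf x K a b = (1 / 2 : ℝ) • tmul (x b - x a) (x b - x a) := by
  -- On a segment all increments are parallel, so `D` is additive; being also quadratically small,
  -- it must vanish.
  set D : I T → I T → PT E := fun s t =>
    areaOf x K s t - (1 / 2 : ℝ) • tmul (x t - x s) (x t - x s) with hD
  have hadd : ∀ s u t : I T, a ≤ s → s ≤ u → u ≤ t → t ≤ b → D s t = D s u + D u t := by
    intro s u t has hsu hut htb
    obtain ⟨c, hc⟩ := hw s u has hsu (hut.trans htb)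
    obtain ⟨c', hc'⟩ := hw u t (has.trans hsu) hut htb
    have e : x t - x s = c • w + c' • w := by rw [← hc, ← hc']; abel
    simp only [hD]
    rw [areaOf_chen x K s u t, e, hc, hc']
    simp only [add_tmul, tmul_add, smul_tmul, tmul_smul, smul_smul, mul_comm c' c]
    module
  have hbound : ∀ s t : I T, s ≤ t → ‖D s t‖ ≤ (C + L ^ 2) * ((t : ℝ) - s) ^ 2 := by
    intro s t hst
    have h1 := hx.2 s t hst
    have h2 : ‖(1 / 2 : ℝ) • tmul (x t - x s) (x t - x s)‖ ≤ L ^ 2 * ((t : ℝ) - s) ^ 2 := by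
      rw [norm_smul, Real.norm_of_nonneg (by norm_num : (0 : ℝ) ≤ 1 / 2)]
      have := mul_le_mul h1 h1 (norm_nonneg _) (mul_nonneg hx.1 (coe_sub_nonneg hst))
      nlinarith [norm_tmul_le (x t - x s) (x t - x s), norm_nonneg (tmul (x t - x s) (x t - x s))]
    rw [add_mul]
    exact (norm_sub_le _ _).trans (add_le_add (hK.2 s t hst) h2)
  -- Each bisection turns `ℓ^2` into `2 (ℓ/2)^2`, gaining a factor `1/2`.
  have hiter : ∀ n : ℕ, ∀ s t : I T, a ≤ s → s ≤ t → t ≤ b →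
      ‖D s t‖ ≤ (C + L ^ 2) * ((t : ℝ) - s) ^ 2 * (1 / 2) ^ n := by
    intro n
    induction n with
    | zero => intro s t _ hst _; simpa using hbound s t hst
    | succ n ih =>
      intro s t has hst htb
      have hst' : (s : ℝ) ≤ t := hst
      let u : I T := ⟨((s : ℝ) + t) / 2,
        by linarith [s.2.1, t.2.1], by linarith [s.2.2, t.2.2]⟩
      have hu : (u : ℝ) = ((s : ℝ) + t) / 2 := rfl
      have hsu : s ≤ u := by rw [← Subtype.coe_le_coe, hu]; linarith
      have hut : u ≤ t := by rw [← Subtype.coe_le_coe, hu]; linarith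
      rw [hadd s u t has hsu hut htb]
      refine (norm_add_le_of_le (ih s u has hsu (hut.trans htb))
        (ih u t (has.trans hsu) hut htb)).trans_eq ?_
      rw [hu, pow_succ]
      ring
  have hlim : Tendsto (fun n : ℕ => (C + L ^ 2) * ((b : ℝ) - a) ^ 2 * (1 / 2 : ℝ) ^ n) atTop
      (𝓝 0) := by
    simpa using (tendsto_pow_atTop_nhds_zero_of_lt_one (r := (1 / 2 : ℝ)) (by norm_num)
      (by norm_num)).const_mul ((C + L ^ 2) * ((b : ℝ) - a) ^ 2)
  have h0 : D a b = 0 := norm_le_zero_iff.1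
    (ge_of_tendsto' hlim fun n => hiter n a b le_rfl hab le_rfl)
  exact sub_eq_zero.1 h0

end LipschitzLift

/-! ### Piecewise linear paths -/

section PiecewiseLinear

variable {E : Type*} [NormedAddCommGroup E] [NormedSpace ℝ E]

/-- The proportion of the interval `[qδ, (q+1)δ]` that lies before `t`. -/
def ramp (δ : ℝ) (q : ℕ) (t : ℝ) : ℝ := min 1 (max 0 (t / δ - q))

theorem ramp_mono {δ : ℝ} (hδ : 0 < δ) (q : ℕ) : Monotone (ramp δ q) := fun s t hst =>
  min_le_min le_rfl (max_le_max le_rfl (sub_le_sub_right (by gcongr) _))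

/-- The ramps are consecutive pieces of `t/δ`. Their total variation is therefore that of one
clipped linear function, which keeps the Lipschitz constant below independent of `M`. -/
theorem sum_ramp {δ t : ℝ} (hδ : 0 < δ) (ht : 0 ≤ t) (M : ℕ) :
    ∑ q ∈ Finset.range M, ramp δ q t = min (M : ℝ) (t / δ) := by
  have h0 : 0 ≤ t / δ := by positivity
  induction M with
  | zero => simp [h0]
  | succ M ih =>
    rw [Finset.sum_range_succ, ih, ramp]
    push_cast
    grind

/-- The piecewise linear path starting at `0` whose increment over `[qδ, (q+1)δ]` is `w q`. -/
def piecewiseLinear (δ : ℝ) (M : ℕ) (w : ℕ → E) (t : ℝ) : E :=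
  ∑ q ∈ Finset.range M, ramp δ q t • w q

theorem norm_piecewiseLinear_sub_le {δ B : ℝ} (hδ : 0 < δ) {M : ℕ} {w : ℕ → E}
    (hB : 0 ≤ B) (hw : ∀ q, ‖w q‖ ≤ B) {s t : ℝ} (hs : 0 ≤ s) (hst : s ≤ t) :
    ‖piecewiseLinear δ M w t - piecewiseLinear δ M w s‖ ≤ B / δ * (t - s) := by
  rw [piecewiseLinear, piecewiseLinear, ← Finset.sum_sub_distrib]
  have h1 : ∀ q ∈ Finset.range M, ‖ramp δ q t • w q - ramp δ q s • w q‖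
      ≤ (ramp δ q t - ramp δ q s) * B := fun q _ => by
    have h := sub_nonneg.2 (ramp_mono hδ q hst)
    rw [← sub_smul, norm_smul, Real.norm_of_nonneg h]
    exact mul_le_mul_of_nonneg_left (hw q) h
  refine (norm_sum_le_of_le _ h1).trans ?_
  rw [← Finset.sum_mul, Finset.sum_sub_distrib, sum_ramp hδ hs, sum_ramp hδ (hs.trans hst)]
  have h2 : s / δ ≤ t / δ := by gcongr
  have h3 : min (M : ℝ) (t / δ) - min (M : ℝ) (s / δ) ≤ t / δ - s / δ := by grind
  calc _ ≤ (t / δ - s / δ) * B := mul_le_mul_of_nonneg_right h3 hB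
    _ = _ := by ring

/-- On the interval number `a`, earlier ramps are already `1` and later ones still `0`. -/
theorem piecewiseLinear_sub {δ : ℝ} (hδ : 0 < δ) {M a : ℕ} (ha : a < M) (w : ℕ → E) {s t : ℝ}
    (hs : a * δ ≤ s) (hst : s ≤ t) (ht : t ≤ (a + 1) * δ) :
    piecewiseLinear δ M w t - piecewiseLinear δ M w s = ((t - s) / δ) • w a := by
  have h1 : (a : ℝ) ≤ s / δ := (le_div_iff₀ hδ).2 hs
  have h2 : s / δ ≤ t / δ := by gcongr
  have h3 : t / δ ≤ a + 1 := (div_le_iff₀ hδ).2 ht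
  rw [piecewiseLinear, piecewiseLinear, ← Finset.sum_sub_distrib,
    Finset.sum_eq_single_of_mem a (Finset.mem_range.2 ha)]
  · rw [← sub_smul, ramp, ramp, sub_div]
    congr 1
    grind
  · intro q _ hq
    rw [← sub_smul, ramp, ramp]
    rcases lt_or_gt_of_ne hq with h | h
    · have : (q : ℝ) + 1 ≤ a := by exact_mod_cast h
      rw [min_eq_left, min_eq_left, sub_self, zero_smul] <;> grind
    · have : (a : ℝ) + 1 ≤ q := by exact_mod_cast h
      rw [max_eq_left, max_eq_left, sub_self, zero_smul] <;> linarith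

/-- The second level over `[0,1]` of the concatenation of the segments in a list. -/
def segArea : List E → PT E
  | [] => 0
  | w :: l => (1 / 2 : ℝ) • tmul w w + segArea l + tmul w l.sum

/-- Chen's relation for concatenated polygonal paths. -/
theorem segArea_append (l l' : List E) :
    segArea (l ++ l') = segArea l + segArea l' + tmul l.sum l'.sum := by
  induction l with
  | nil => simp [segArea, zero_tmul]
  | cons w l ih =>
    simp only [List.cons_append, segArea, ih, List.sum_append, List.sum_cons, tmul_add, add_tmul]
    abel

/-- The concatenation of parallelograms with the given sides. -/
def loops : List (E × E) → List E
  | [] => []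
  | p :: l => [p.1, p.2, -p.1, -p.2] ++ loops l

omit [NormedSpace ℝ E] in
theorem length_loops (l : List (E × E)) : (loops l).length = 4 * l.length := by
  induction l with
  | nil => rfl
  | cons p l ih => simp only [loops, List.length_append, ih, List.length_cons, List.length_nil]; ring

omit [NormedSpace ℝ E] in
theorem sum_loops (l : List (E × E)) : (loops l).sum = 0 := by
  induction l with
  | nil => rfl
  | cons p l ih => simp [loops, ih]

omit [NormedSpace ℝ E] in
theorem norm_le_of_mem_loops {B : ℝ} {l : List (E × E)}
    (h : ∀ p ∈ l, ‖p.1‖ ≤ B ∧ ‖p.2‖ ≤ B) : ∀ w ∈ loops l, ‖w‖ ≤ B := by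
  induction l with
  | nil => simp [loops]
  | cons p l ih =>
    intro w hw
    obtain ⟨h1, h2⟩ := h p List.mem_cons_self
    rcases List.mem_append.1 hw with hw | hw
    · simp only [List.mem_cons, List.not_mem_nil, or_false] at hw
      rcases hw with rfl | rfl | rfl | rfl <;> simpa
    · exact ih (fun q hq => h q (List.mem_cons_of_mem _ hq)) w hw

/-- A parallelogram with sides `a`, `b` closes up and has second level `a ⊗ b - b ⊗ a`. Since closed
loops have zero increment, concatenation creates no cross terms. -/
theorem segArea_loops (l : List (E × E)) :
    segArea (loops l) = (l.map fun p => tmul p.1 p.2 - tmul p.2 p.1).sum := by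
  induction l with
  | nil => rfl
  | cons p l ih =>
    rw [loops, segArea_append, ih, sum_loops, tmul_zero, add_zero, List.map_cons, List.sum_cons]
    congr 1
    simp only [segArea, List.sum_cons, List.sum_nil, tmul_add, tmul_neg, neg_tmul, tmul_zero,
      add_zero]
    module

variable {T : ℝ}

/-- Increment and area of a piecewise linear path over consecutive segments. -/
theorem areaOf_piecewiseLinear {δ C L : ℝ} (hδ : 0 < δ) {M : ℕ} {w : ℕ → E} {K : I T → PT E}
    (hx : LipBound L fun t : I T => piecewiseLinear δ M w t)
    (hK : AreaBound C (fun t : I T => piecewiseLinear δ M w t) K) {τ : ℕ → I T}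
    (hτ : ∀ q ≤ M, (τ q : ℝ) = q * δ) (l : List E) (a : ℕ) (ha : a + l.length ≤ M)
    (hl : ∀ (r : ℕ) (hr : r < l.length), w (a + r) = l[r]) :
    piecewiseLinear δ M w (τ (a + l.length)) - piecewiseLinear δ M w (τ a) = l.sum ∧
      areaOf (fun t : I T => piecewiseLinear δ M w t) K (τ a) (τ (a + l.length)) = segArea l := by
  induction l generalizing a with
  | nil => simp [segArea, areaOf_self]
  | cons v l ih =>
    rw [List.length_cons] at ha
    have hv : w a = v := hl 0 (by simp)
    have e : a + (v :: l).length = a + 1 + l.length := by rw [List.length_cons]; ring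
    obtain ⟨h1, h2⟩ := ih (a + 1) (by omega) fun r hr => by
      have := hl (r + 1) (by simpa using hr)
      rw [show a + 1 + r = a + (r + 1) by ring, this]
      rfl
    have hτ0 := hτ a (by omega)
    have hτ1 : (τ (a + 1) : ℝ) = (a + 1) * δ := by
      have := hτ (a + 1) (by omega)
      push_cast at this
      exact this
    have hle : τ a ≤ τ (a + 1) := by
      rw [← Subtype.coe_le_coe, hτ0, hτ1]
      nlinarith
    have hinc : piecewiseLinear δ M w (τ (a + 1)) - piecewiseLinear δ M w (τ a) = v := by
      rw [piecewiseLinear_sub hδ (by omega : a < M) w hτ0.ge hle hτ1.le, hv, hτ0, hτ1]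
      have : ((a + 1) * δ - a * δ) / δ = 1 := by field_simp; ring
      rw [this, one_smul]
    have harea := hK.areaOf_segment hx hle (w := w a) fun s t has hst htb =>
      ⟨_, piecewiseLinear_sub hδ (by omega : a < M) w (hτ0.symm.trans_le has) hst
        ((Subtype.coe_le_coe.2 htb).trans_eq hτ1)⟩
    simp only [hinc] at harea
    rw [e]
    constructor
    · rw [List.sum_cons, ← h1, ← hinc]
      abel
    · rw [areaOf_chen _ K (τ a) (τ (a + 1)) (τ (a + 1 + l.length)), harea, h2, segArea]
      simp only [hinc, h1]

end PiecewiseLinear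

/-! ### Approximation by lifts of piecewise linear paths -/

section Approximation

variable {T : ℝ} {E : Type*} [NormedAddCommGroup E] [NormedSpace ℝ E]

/-- Paths with equal increments and with close areas over consecutive intervals have close areas
over unions of these intervals. -/
theorem norm_areaOf_sub_areaOf_le {X x : I T → E} {J K : I T → PT E} {σ : ℕ → I T} {n : ℕ} {R : ℝ}
    (h1 : ∀ j < n, x (σ (j + 1)) - x (σ j) = X (σ (j + 1)) - X (σ j))
    (h2 : ∀ j < n, ‖areaOf X J (σ j) (σ (j + 1)) - areaOf x K (σ j) (σ (j + 1))‖ ≤ R)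
    {i j : ℕ} (hij : i ≤ j) (hj : j ≤ n) :
    x (σ j) - x (σ i) = X (σ j) - X (σ i) ∧
      ‖areaOf X J (σ i) (σ j) - areaOf x K (σ i) (σ j)‖ ≤ ((j : ℝ) - i) * R := by
  induction j, hij using Nat.le_induction with
  | base => simp [areaOf_self]
  | succ j hij ih =>
    obtain ⟨e1, e2⟩ := ih (by omega)
    have e3 := h1 j (by omega)
    refine ⟨?_, ?_⟩
    · rw [← sub_add_sub_cancel (x (σ (j + 1))) (x (σ j)), e1, e3, sub_add_sub_cancel]
    -- The increments agree, so the cross terms of Chen's relation cancel in the difference.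
    · rw [areaOf_chen X J (σ i) (σ j) (σ (j + 1)), areaOf_chen x K (σ i) (σ j) (σ (j + 1)), e1, e3,
        add_sub_add_right_eq_sub, add_sub_add_comm]
      refine (norm_add_le_of_le e2 (h2 j (by omega))).trans_eq ?_
      push_cast
      ring

/-- A path of finite variation with prescribed increments, and areas of the form
`½ v ⊗ v + ∑_p (a_p ⊗ b_p - b_p ⊗ a_p)`, over the intervals of a uniform partition. -/
theorem exists_lipschitz_interpolation (hT : 0 < T) {ι : Type*} [Fintype ι] (X : I T → E)
    (J : I T → PT E) (a b : ι → I T → I T → E) {n : ℕ} (hn : 0 < n) {B R : ℝ} (hB : 0 ≤ B)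
    (hX : ∀ s t : I T, (t : ℝ) - s = T / n → ‖X t - X s‖ ≤ B)
    (hab : ∀ s t : I T, (t : ℝ) - s = T / n → ∀ p, ‖a p s t‖ ≤ B ∧ ‖b p s t‖ ≤ B)
    (hR : ∀ s t : I T, (t : ℝ) - s = T / n →
      ‖areaOf X J s t - (1 / 2 : ℝ) • tmul (X t - X s) (X t - X s)
        - ∑ p, (tmul (a p s t) (b p s t) - tmul (b p s t) (a p s t))‖ ≤ R) :
    ∃ (x : I T → E) (K : I T → PT E) (L : ℝ),
      L = B * (4 * Fintype.card ι + 1) / (T / n) ∧ LipBound L x ∧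
      AreaBound (sewConst 2 * L ^ 2) x K ∧
      ∀ i j : ℕ, i ≤ j → j ≤ n → ∀ s t : I T, (s : ℝ) = i * (T / n) → (t : ℝ) = j * (T / n) →
        x t - x s = X t - X s ∧
          ‖areaOf X J s t - areaOf x K s t‖ ≤ ((j : ℝ) - i) * R := by
  -- Segments per cell: four for each parallelogram and one for the chord of `X`.
  set N : ℕ := 4 * Fintype.card ι + 1 with hN
  have hNpos : 0 < N := Nat.succ_pos _
  have hn' : (0 : ℝ) < n := Nat.cast_pos.2 hn
  have hN' : (0 : ℝ) < N := Nat.cast_pos.2 hNpos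
  set δ : ℝ := T / n / N with hδdef
  have hδ : 0 < δ := by positivity
  have hNδ : N * δ = T / n := by rw [hδdef]; field_simp
  set τ : ℕ → I T := fun q => projIcc 0 T hT.le (q * δ) with hτdef
  have hτ : ∀ q ≤ n * N, (τ q : ℝ) = q * δ := fun q hq => by
    have h1 : (q : ℝ) * δ ≤ T := by
      have h2 : (q : ℝ) ≤ n * N := by exact_mod_cast hq
      calc (q : ℝ) * δ ≤ n * N * δ := by gcongr
        _ = T := by rw [mul_assoc, hNδ]; field_simp
    rw [hτdef]
    simp only
    rw [projIcc_of_mem hT.le ⟨by positivity, h1⟩]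
  set σ : ℕ → I T := fun j => τ (j * N) with hσdef
  have hσ : ∀ j ≤ n, (σ j : ℝ) = j * (T / n) := fun j hj => by
    rw [hσdef]
    simp only
    rw [hτ _ (Nat.mul_le_mul_right N hj), Nat.cast_mul, mul_assoc, hNδ]
  have hσ1 : ∀ j < n, (σ (j + 1) : ℝ) - σ j = T / n := fun j hj => by
    rw [hσ j hj.le, hσ (j + 1) hj]
    push_cast
    ring
  set sides : ℕ → List (E × E) := fun j => (Finset.univ : Finset ι).toList.map fun p =>
    (a p (σ j) (σ (j + 1)), b p (σ j) (σ (j + 1))) with hsides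
  -- The loops carry the antisymmetric area, the chord carries the increment and `½ v ⊗ v`; a loop
  -- adds no cross term with the chord.
  set segs : ℕ → List E := fun j => loops (sides j) ++ [X (σ (j + 1)) - X (σ j)] with hsegs
  have hlen : ∀ j, (segs j).length = N := fun j => by
    simp [hsegs, hsides, length_loops, hN]
  have hsum : ∀ j, (segs j).sum = X (σ (j + 1)) - X (σ j) := fun j => by
    simp [hsegs, sum_loops]
  have harea : ∀ j, segArea (segs j)
      = (1 / 2 : ℝ) • tmul (X (σ (j + 1)) - X (σ j)) (X (σ (j + 1)) - X (σ j))
        + ∑ p, (tmul (a p (σ j) (σ (j + 1))) (b p (σ j) (σ (j + 1)))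
          - tmul (b p (σ j) (σ (j + 1))) (a p (σ j) (σ (j + 1)))) := fun j => by
    rw [hsegs]
    simp only
    rw [segArea_append, sum_loops, zero_tmul, add_zero, segArea_loops, hsides]
    simp only [segArea, List.sum_nil, tmul_zero, add_zero, List.map_map, Function.comp_def,
      Finset.sum_map_toList]
    rw [add_comm]
  have hsmall : ∀ j < n, ∀ v ∈ segs j, ‖v‖ ≤ B := by
    intro j hj v hv
    rcases List.mem_append.1 hv with hv | hv
    · refine norm_le_of_mem_loops (fun q hq => ?_) v hv
      obtain ⟨p, -, rfl⟩ := List.mem_map.1 hq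
      exact hab _ _ (hσ1 j hj) p
    · rw [List.mem_singleton.1 hv]
      exact hX _ _ (hσ1 j hj)
  -- Segment `q` is entry `q % N` of cell `q / N`. The `getD` default is never read, since every
  -- list has length `N`; the value `0` past the last cell makes the norm bound hold for all `q`.
  set w : ℕ → E := fun q => if q < n * N then (segs (q / N)).getD (q % N) 0 else 0 with hw
  have hwB : ∀ q, ‖w q‖ ≤ B := fun q => by
    rw [hw]
    simp only
    split_ifs with hq
    · have h1 : q % N < (segs (q / N)).length := by
        rw [hlen]
        exact Nat.mod_lt _ hNpos
      rw [List.getD_eq_getElem _ _ h1]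
      exact hsmall _ (Nat.div_lt_of_lt_mul (by rwa [mul_comm])) _ (List.getElem_mem h1)
    · simpa using hB
  have hwseg : ∀ j < n, ∀ (r : ℕ) (hr : r < (segs j).length), w (j * N + r) = (segs j)[r] := by
    intro j hj r hr
    have hr' : r < N := by rwa [hlen] at hr
    have h1 : j * N + r < n * N := by
      calc j * N + r < j * N + N := by omega
        _ = (j + 1) * N := by ring
        _ ≤ n * N := Nat.mul_le_mul_right N hj
    have h2 : (j * N + r) / N = j := by
      rw [mul_comm, Nat.mul_add_div hNpos, Nat.div_eq_of_lt hr', add_zero]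
    have h3 : (j * N + r) % N = r := by
      rw [mul_comm, Nat.mul_add_mod, Nat.mod_eq_of_lt hr']
    rw [hw]
    simp only
    rw [if_pos h1, h2, h3, List.getD_eq_getElem _ _ hr]
  have hLip : LipBound (B / δ) fun t : I T => piecewiseLinear δ (n * N) w t :=
    ⟨by positivity, fun s t hst => norm_piecewiseLinear_sub_le hδ hB hwB s.2.1 hst⟩
  obtain ⟨K, hK⟩ := hLip.exists_area hT.le
  have hblock : ∀ j < n, _ := fun j hj => areaOf_piecewiseLinear hδ hLip hK hτ (segs j) (j * N)
    (by rw [hlen]; calc j * N + N = (j + 1) * N := by ring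
          _ ≤ n * N := Nat.mul_le_mul_right N hj) (hwseg j hj)
  have hnext : ∀ j, τ (j * N + (segs j).length) = σ (j + 1) := fun j => by
    rw [hlen, hσdef]
    simp only
    rw [add_mul, one_mul]
  refine ⟨_, K, B / δ, ?_, hLip, hK, fun i j hij hj s t hs ht => ?_⟩
  · rw [hδdef, hN]
    push_cast
    field_simp
  · have es : s = σ i := Subtype.ext (hs.trans (hσ i (hij.trans hj)).symm)
    have et : t = σ j := Subtype.ext (ht.trans (hσ j hj).symm)
    rw [es, et]
    refine norm_areaOf_sub_areaOf_le (σ := σ) (x := fun t : I T => piecewiseLinear δ (n * N) w t)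
      (fun j hj => ?_) (fun j hj => ?_) hij hj
    · have h := (hblock j hj).1
      rw [hnext, hsum] at h
      exact h
    · have h := (hblock j hj).2
      rw [hnext, harea] at h
      have e : areaOf (fun t : I T => piecewiseLinear δ (n * N) w t) K (σ j) (σ (j + 1)) = _ := h
      rw [e, ← sub_sub]
      exact hR _ _ (hσ1 j hj)

/-- Two lifted paths are close if they are small at scales below `h` and agree, up to a small
error in the area, on a grid of mesh `h`. -/
theorem norm_sub_le_of_grid {X x : I T → E} {J K : I T → PT E} {α h e M : ℝ} (hα : 0 < α)
    (he : 0 ≤ e)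
    (hX : ∀ s t : I T, s ≤ t → ‖X t - X s‖ ≤ M * ((t : ℝ) - s) ^ α)
    (hXs : ∀ s t : I T, s ≤ t → (t : ℝ) - s ≤ h → ‖X t - X s‖ ≤ e * ((t : ℝ) - s) ^ α)
    (hxs : ∀ s t : I T, s ≤ t → (t : ℝ) - s ≤ h → ‖x t - x s‖ ≤ e * ((t : ℝ) - s) ^ α)
    (hJs : ∀ s t : I T, s ≤ t → (t : ℝ) - s ≤ h →
      ‖areaOf X J s t‖ ≤ e * ((t : ℝ) - s) ^ (2 * α))
    (hKs : ∀ s t : I T, s ≤ t → (t : ℝ) - s ≤ h →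
      ‖areaOf x K s t‖ ≤ e * ((t : ℝ) - s) ^ (2 * α))
    (hgrid : ∀ s t : I T, h < (t : ℝ) - s → ∃ p q : I T, s ≤ p ∧ p ≤ q ∧ q ≤ t ∧
      (p : ℝ) - s ≤ h ∧ (t : ℝ) - q ≤ h ∧ x q - x p = X q - X p ∧
      ‖areaOf X J p q - areaOf x K p q‖ ≤ e * ((q : ℝ) - p) ^ (2 * α))
    (hM : 0 ≤ M) (s t : I T) (hst : s < t) :
    ‖(X t - x t) - (X s - x s)‖ ≤ 4 * e * ((t : ℝ) - s) ^ α ∧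
      ‖areaOf X J s t - areaOf x K s t‖ ≤ e * (5 + 4 * M + e) * ((t : ℝ) - s) ^ (2 * α) := by
  have hst' := coe_sub_pos hst
  set d : ℝ := ((t : ℝ) - s) ^ α with hd
  have hd0 : 0 ≤ d := Real.rpow_nonneg hst'.le _
  have hdd : ((t : ℝ) - s) ^ (2 * α) = d * d := by
    rw [two_mul, Real.rpow_add hst']
  rw [hdd]
  have hed : 0 ≤ e * (d * d) := by positivity
  have hMed : 0 ≤ M * (e * (d * d)) := by positivity
  have heed : 0 ≤ e * (e * (d * d)) := by positivity
  have mono1 : ∀ {u v : I T}, s ≤ u → u ≤ v → v ≤ t → ((v : ℝ) - u) ^ α ≤ d :=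
    fun {u v} h1 h2 h3 => Real.rpow_le_rpow (coe_sub_nonneg h2)
      (by have := coe_sub_nonneg h1; have := coe_sub_nonneg h3; linarith) hα.le
  have mono2 : ∀ {u v : I T}, s ≤ u → u ≤ v → v ≤ t → ((v : ℝ) - u) ^ (2 * α) ≤ d * d :=
    fun {u v} h1 h2 h3 => by
      rw [← hdd]
      exact Real.rpow_le_rpow (coe_sub_nonneg h2)
        (by have := coe_sub_nonneg h1; have := coe_sub_nonneg h3; linarith) (by linarith)
  rcases le_or_gt ((t : ℝ) - s) h with hh | hh
  · have a1 := hXs s t hst.le hh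
    have a2 := hxs s t hst.le hh
    have a3 := hJs s t hst.le hh
    have a4 := hKs s t hst.le hh
    rw [hdd] at a3 a4
    have hed' : 0 ≤ e * d := by positivity
    constructor
    · rw [sub_sub_sub_comm]
      refine (norm_sub_le_of_le a1 a2).trans ?_
      linarith
    · refine (norm_sub_le_of_le a3 a4).trans ?_
      linarith
  · obtain ⟨p, q, h1, h2, h3, h4, h5, h6, h7⟩ := hgrid s t hh
    have a1 : ‖X p - X s‖ ≤ e * d := (hXs s p h1 h4).trans
      (mul_le_mul_of_nonneg_left (mono1 le_rfl h1 (h2.trans h3)) he)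
    have a2 : ‖x p - x s‖ ≤ e * d := (hxs s p h1 h4).trans
      (mul_le_mul_of_nonneg_left (mono1 le_rfl h1 (h2.trans h3)) he)
    have a3 : ‖X t - X q‖ ≤ e * d := (hXs q t h3 h5).trans
      (mul_le_mul_of_nonneg_left (mono1 (h1.trans h2) h3 le_rfl) he)
    have a4 : ‖x t - x q‖ ≤ e * d := (hxs q t h3 h5).trans
      (mul_le_mul_of_nonneg_left (mono1 (h1.trans h2) h3 le_rfl) he)
    have a5 : ‖X q - X p‖ ≤ M * d := (hX p q h2).trans
      (mul_le_mul_of_nonneg_left (mono1 h1 h2 h3) hM)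
    have a6 : ‖X t - X p‖ ≤ M * d := (hX p t (h2.trans h3)).trans
      (mul_le_mul_of_nonneg_left (mono1 h1 (h2.trans h3) le_rfl) hM)
    have b1 : ‖areaOf X J s p‖ ≤ e * (d * d) := (hJs s p h1 h4).trans
      (mul_le_mul_of_nonneg_left (mono2 le_rfl h1 (h2.trans h3)) he)
    have b2 : ‖areaOf x K s p‖ ≤ e * (d * d) := (hKs s p h1 h4).trans
      (mul_le_mul_of_nonneg_left (mono2 le_rfl h1 (h2.trans h3)) he)
    have b3 : ‖areaOf X J q t‖ ≤ e * (d * d) := (hJs q t h3 h5).trans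
      (mul_le_mul_of_nonneg_left (mono2 (h1.trans h2) h3 le_rfl) he)
    have b4 : ‖areaOf x K q t‖ ≤ e * (d * d) := (hKs q t h3 h5).trans
      (mul_le_mul_of_nonneg_left (mono2 (h1.trans h2) h3 le_rfl) he)
    have b5 : ‖areaOf X J p q - areaOf x K p q‖ ≤ e * (d * d) := h7.trans
      (mul_le_mul_of_nonneg_left (mono2 h1 h2 h3) he)
    have tm : ∀ {v w : E} {c c' : ℝ}, ‖v‖ ≤ c → ‖w‖ ≤ c' → ‖tmul v w‖ ≤ c * c' :=
      fun hv hw => (norm_tmul_le _ _).trans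
        (mul_le_mul hv hw (norm_nonneg _) ((norm_nonneg _).trans hv))
    -- No bound on `x` at large scales is assumed, so its increment goes through `q`, where it
    -- agrees with that of `X` from `p`.
    have c0 : ‖x t - x p‖ ≤ M * d + e * d := by
      rw [← sub_add_sub_cancel (x t) (x q), add_comm, h6]
      exact norm_add_le_of_le a5 a4
    have c1 := tm a1 a6
    have c2 := tm a2 c0
    have c3 := tm a5 a3
    have c4 := tm a5 a4
    constructor
    · have e1 : (X t - x t) - (X s - x s)
          = ((X p - X s) - (x p - x s)) + ((X t - X q) - (x t - x q)) := by
        have : X q - x q = X p - x p := by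
          rw [sub_eq_sub_iff_sub_eq_sub]
          exact h6.symm
        rw [sub_sub_sub_comm (X p) (X s), sub_sub_sub_comm (X t) (X q), this]
        abel
      rw [e1]
      refine (norm_add_le_of_le (norm_sub_le_of_le a1 a2) (norm_sub_le_of_le a3 a4)).trans_eq ?_
      ring
    -- Chen at `p` and `q`: the five areas give `5e`, the cross terms `4eM + e^2`; the largest cross
    -- terms, over `[p,q]` for the areas, enter only through a difference.
    · rw [areaOf_chen X J s p t, areaOf_chen X J p q t, areaOf_chen x K s p t,
        areaOf_chen x K p q t, h6]
      have e1 : ∀ A B C P Q A' B' C' P' Q' : PT E,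
          A + (B + C + P) + Q - (A' + (B' + C' + P') + Q')
            = (A - A') + (B - B') + (C - C') + (P - P') + (Q - Q') := by
        intros; abel
      rw [e1]
      refine (norm_add_le_of_le (norm_add_le_of_le (norm_add_le_of_le (norm_add_le_of_le
        (norm_sub_le_of_le b1 b2) b5) (norm_sub_le_of_le b3 b4)) (norm_sub_le_of_le c3 c4))
        (norm_sub_le_of_le c1 c2)).trans ?_
      linarith

/-- `p` is the first grid point at or after `s` and `q` the last at or before `t`; an interval
longer than the mesh contains a grid point, hence `p ≤ q`. -/
theorem exists_grid_points (hT : 0 < T) {n : ℕ} (hn : 0 < n) {s t : I T}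
    (hst : T / n < (t : ℝ) - s) : ∃ i j : ℕ, ∃ p q : I T, i ≤ j ∧ j ≤ n ∧
      (p : ℝ) = i * (T / n) ∧ (q : ℝ) = j * (T / n) ∧ s ≤ p ∧ p ≤ q ∧ q ≤ t ∧
      (p : ℝ) - s ≤ T / n ∧ (t : ℝ) - q ≤ T / n := by
  have hn' : (0 : ℝ) < n := Nat.cast_pos.2 hn
  set h : ℝ := T / n with hh
  have hpos : 0 < h := by positivity
  have hTh : n * h = T := by rw [hh]; field_simp
  have hs0 : 0 ≤ (s : ℝ) / h := div_nonneg s.2.1 hpos.le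
  have ht0 : 0 ≤ (t : ℝ) / h := div_nonneg t.2.1 hpos.le
  have i1 : (s : ℝ) ≤ ⌈(s : ℝ) / h⌉₊ * h := (div_le_iff₀ hpos).1 (Nat.le_ceil _)
  have i2 : (⌈(s : ℝ) / h⌉₊ : ℝ) * h ≤ s + h := by
    have := (Nat.ceil_lt_add_one hs0).le
    calc (⌈(s : ℝ) / h⌉₊ : ℝ) * h ≤ (s / h + 1) * h := by gcongr
      _ = s + h := by field_simp
  have j1 : (⌊(t : ℝ) / h⌋₊ : ℝ) * h ≤ t := (le_div_iff₀ hpos).1 (Nat.floor_le ht0)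
  have j2 : (t : ℝ) ≤ ⌊(t : ℝ) / h⌋₊ * h + h := by
    have := (Nat.lt_floor_add_one ((t : ℝ) / h)).le
    rw [div_le_iff₀ hpos] at this
    linarith
  set i := ⌈(s : ℝ) / h⌉₊
  set j := ⌊(t : ℝ) / h⌋₊
  have hij : i ≤ j := by
    have : (i : ℝ) < j + 1 := by
      by_contra! hcon
      nlinarith
    exact_mod_cast Nat.lt_succ_iff.1 (by exact_mod_cast this)
  have hjn : j ≤ n := by
    have : (j : ℝ) ≤ n := by
      by_contra! hcon
      nlinarith [t.2.2]
    exact_mod_cast this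
  have hijr : (i : ℝ) * h ≤ j * h := by gcongr
  refine ⟨i, j, ⟨i * h, by positivity, by linarith [t.2.2]⟩, ⟨j * h, by positivity,
    by linarith [t.2.2]⟩, hij, hjn, rfl, rfl, i1, hijr, j1, ?_, ?_⟩
  · simp only
    linarith
  · simp only
    linarith

/-- For `x ≤ h ≤ 1`, a bound of order `b ≥ a + η` yields the factor `h^η` in a bound of
order `a`. -/
theorem le_mul_rpow_mul_rpow {a b η x h A C y : ℝ} (ha : 0 < a) (hη : 0 ≤ η) (hab : a + η ≤ b)
    (hx : 0 ≤ x) (hxh : x ≤ h) (h0 : 0 < h) (h1 : h ≤ 1) (hA : 0 ≤ A) (hAC : A ≤ C)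
    (hy : y ≤ A * x ^ b) : y ≤ C * h ^ η * x ^ a := by
  have hC := hA.trans hAC
  rcases hx.eq_or_lt with rfl | hx
  · rw [Real.zero_rpow (by linarith : 0 < b).ne', mul_zero] at hy
    rwa [Real.zero_rpow ha.ne', mul_zero]
  · calc y ≤ A * x ^ b := hy
      _ ≤ C * (h ^ (b - a) * x ^ a) :=
        mul_le_mul hAC (rpow_le_rpow_mul_rpow hx hxh (by linarith)) (by positivity) hC
      _ ≤ C * (h ^ η * x ^ a) := by
        gcongr C * (?_ * _)
        exact Real.rpow_le_rpow_of_exponent_ge h0 h1 (by linarith)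
      _ = _ := by ring

/-- At scales below `h`, a Lipschitz bound with constant of order `h^(b-1)` is a Hoelder bound. -/
theorem div_mul_le_rpow {b x h : ℝ} (hb : 0 < b) (hb1 : b ≤ 1) (hx : 0 ≤ x) (hxh : x ≤ h)
    (h0 : 0 < h) : h ^ b / h * x ≤ x ^ b := by
  rcases hx.eq_or_lt with rfl | hx
  · rw [mul_zero, Real.zero_rpow hb.ne']
  · have h1 := rpow_le_rpow_mul_rpow hx hxh hb1
    rw [Real.rpow_one] at h1
    calc h ^ b / h * x ≤ h ^ b / h * (h ^ (1 - b) * x ^ b) := by gcongr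
      _ = (h ^ b * h ^ (1 - b)) / h * x ^ b := by ring
      _ = x ^ b := by
        rw [← Real.rpow_add h0, add_sub_cancel, Real.rpow_one, div_self h0.ne', one_mul]

theorem exists_ofReal_le {ε : ℝ≥0∞} (hε : 0 < ε) : ∃ r : ℝ, 0 < r ∧ ENNReal.ofReal r ≤ ε := by
  -- The minimum with `1` covers `ε = ∞`.
  refine ⟨(min ε 1).toReal, ENNReal.toReal_pos (by simp [hε.ne']) (by simp), ?_⟩
  rw [ENNReal.ofReal_toReal (by simp)]
  exact min_le_left _ _

/-- A rough path whose second level is, up to terms of order `|t-s|^κ` with `κ > 1`, the sum of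
`½ X_{st} ⊗ X_{st}` and of finitely many antisymmetric tensors `a ⊗ b - b ⊗ a`, with `a` and `b`
of order `|t-s|^β`, is geometric for the exponents `α < β`. -/
theorem isGeometric_areaOf (hT : 0 < T) {α β κ : ℝ} (hα : 0 < α) (hα2 : 2 * α ≤ 1) (hαβ : α < β)
    (hβ : β ≤ 1) (hκ : 1 < κ) {ι : Type*} [Fintype ι] {X : I T → E} {J : I T → PT E}
    {a b : ι → I T → I T → E} (ha : ∀ p, HBound β (a p)) (hb : ∀ p, HBound β (b p))
    (hX : HBound β (incr X)) (hJ : HBound (2 * β) (areaOf X J))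
    (hexp : HBound κ fun s t => areaOf X J s t - (1 / 2 : ℝ) • tmul (X t - X s) (X t - X s)
      - ∑ p, (tmul (a p s t) (b p s t) - tmul (b p s t) (a p s t))) :
    IsGeometric α X (areaOf X J) := by
  refine ⟨isRoughPath_areaOf hα (hX.mono hαβ.le) (hJ.mono (by linarith)), fun ε hε => ?_⟩
  obtain ⟨M, hM, hXM⟩ := hX.mono hαβ.le
  obtain ⟨C₁, hC₁, hX⟩ := hX
  obtain ⟨C₂, hC₂, hJ⟩ := hJ
  obtain ⟨C₃, hC₃, hexp⟩ := hexp
  choose Ca hCa ha using ha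
  choose Cb hCb hb using hb
  have hsa : 0 ≤ ∑ p, Ca p := Finset.sum_nonneg fun p _ => hCa p
  have hsb : 0 ≤ ∑ p, Cb p := Finset.sum_nonneg fun p _ => hCb p
  have hca : ∀ p, Ca p ≤ ∑ p, Ca p := fun p =>
    Finset.single_le_sum (fun p _ => hCa p) (Finset.mem_univ p)
  have hcb : ∀ p, Cb p ≤ ∑ p, Cb p := fun p =>
    Finset.single_le_sum (fun p _ => hCb p) (Finset.mem_univ p)
  obtain ⟨A, hA, hA1, hA2, hA3, hAa, hAb⟩ : ∃ A : ℝ, 0 ≤ A ∧ C₁ ≤ A ∧ C₂ ≤ A ∧ C₃ ≤ A ∧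
      (∀ p, Ca p ≤ A) ∧ ∀ p, Cb p ≤ A :=
    ⟨C₁ + C₂ + C₃ + ∑ p, Ca p + ∑ p, Cb p, by linarith, by linarith, by linarith, by linarith,
      fun p => by linarith [hca p], fun p => by linarith [hcb p]⟩
  set N : ℝ := 4 * Fintype.card ι + 1 with hN
  have hN0 : 0 ≤ N := by positivity
  have hsew : 0 ≤ sewConst 2 := (sewConst_pos one_lt_two).le
  -- `η` is the power of `h` gained: `β - α` inside the cells, `κ - 1` from summing area errors over
  -- cells.
  set η : ℝ := min (β - α) (κ - 1) with hηdef
  have hη : 0 < η := lt_min (by linarith) (by linarith)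
  have hη1 : η ≤ β - α := min_le_left _ _
  have hη2 : η ≤ κ - 1 := min_le_right _ _
  have hAN : 0 ≤ A * N := mul_nonneg hA hN0
  have hAN2 : 0 ≤ sewConst 2 * (A * N) ^ 2 := mul_nonneg hsew (sq_nonneg _)
  have hAT : 0 ≤ A * T ^ (1 - 2 * α) := mul_nonneg hA (Real.rpow_nonneg hT.le _)
  -- The summands serve, in order, `X` and its area, the increments of `x`, the area of `x`, and the
  -- area error on the grid.
  set C : ℝ := A + A * N + sewConst 2 * (A * N) ^ 2 + A * T ^ (1 - 2 * α) with hC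
  have hC0 : 0 ≤ C := by linarith
  obtain ⟨r, hr, hrε⟩ := exists_ofReal_le hε
  -- The total distance will be at most `4e + e (5 + 4M + e)` with `e = C h^η ≤ C`.
  obtain ⟨δ, hδ, hsmall⟩ := exists_mul_rpow_lt (C * (9 + 4 * M + C)) hη hr
  obtain ⟨n, hnδ⟩ := exists_nat_gt (T / min δ 1)
  have hmin : 0 < min δ 1 := lt_min hδ one_pos
  have hn' : (0 : ℝ) < n := lt_trans (by positivity) hnδ
  have hn : 0 < n := Nat.cast_pos.1 hn'
  set h : ℝ := T / n with hh
  have hh0 : 0 < h := by positivity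
  have hhmin : h ≤ min δ 1 := by
    rw [div_lt_iff₀ hmin] at hnδ
    rw [hh, div_le_iff₀ hn']
    linarith
  have hh1 : h ≤ 1 := hhmin.trans (min_le_right _ _)
  have lt_of_eq : ∀ s t : I T, (t : ℝ) - s = h → s < t := fun s t hst => by
    rw [← Subtype.coe_lt_coe]
    linarith
  obtain ⟨x, K, L, hL, hxL, hKL, hgrid⟩ := exists_lipschitz_interpolation hT X J a b hn
    (B := A * h ^ β) (R := A * h ^ κ) (by positivity)
    (fun s t hst => by
      refine (hX s t (lt_of_eq s t hst)).trans ?_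
      rw [hst]
      gcongr)
    (fun s t hst p => by
      refine ⟨(ha p s t (lt_of_eq s t hst)).trans ?_, (hb p s t (lt_of_eq s t hst)).trans ?_⟩
      · rw [hst]
        exact mul_le_mul_of_nonneg_right (hAa p) (by positivity)
      · rw [hst]
        exact mul_le_mul_of_nonneg_right (hAb p) (by positivity))
    (fun s t hst => by
      refine (hexp s t (lt_of_eq s t hst)).trans ?_
      rw [hst]
      gcongr)
  set e : ℝ := C * h ^ η with he
  have he0 : 0 ≤ e := by positivity
  -- Here `L = A N h^(β-1)`, so at scales below `h` the path `x` is `β`-Hoelder with a constant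
  -- independent of `h`.
  have hLx : ∀ y : ℝ, 0 ≤ y → y ≤ h → L * y ≤ A * N * y ^ β := fun y hy hyh => by
    rw [hL]
    calc _ = A * N * (h ^ β / h * y) := by ring
      _ ≤ _ := mul_le_mul_of_nonneg_left (div_mul_le_rpow (hα.trans hαβ) hβ hy hyh hh0) hAN
  have hclose := norm_sub_le_of_grid (X := X) (x := x) (J := J) (K := K) (h := h) (e := e)
    (M := M) hα he0
    (fun s t hst => by
      rcases hst.eq_or_lt with rfl | hst
      · simp [Real.zero_rpow hα.ne']
      · exact hXM s t hst)
    (fun s t hst hsth => by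
      have h0 := coe_sub_nonneg hst
      rcases hst.eq_or_lt with rfl | hst
      · simp [Real.zero_rpow hα.ne']
      · exact le_mul_rpow_mul_rpow hα hη.le (by linarith) h0 hsth hh0 hh1 hC₁ (by linarith)
          (hX s t hst))
    (fun s t hst hsth => by
      have h0 := coe_sub_nonneg hst
      exact le_mul_rpow_mul_rpow hα hη.le (by linarith) h0 hsth hh0 hh1 hAN (by linarith)
        ((hxL.2 s t hst).trans (hLx _ h0 hsth)))
    (fun s t hst hsth => by
      have h0 := coe_sub_nonneg hst
      rcases hst.eq_or_lt with rfl | hst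
      · simp [areaOf_self, Real.zero_rpow (mul_pos two_pos hα).ne']
      · exact le_mul_rpow_mul_rpow (by linarith) hη.le (by linarith) h0 hsth hh0 hh1 hC₂
          (by linarith) (hJ s t hst))
    (fun s t hst hsth => by
      have h0 := coe_sub_nonneg hst
      refine le_mul_rpow_mul_rpow (b := 2 * β) (by linarith) hη.le (by linarith) h0 hsth hh0 hh1
        hAN2 (by linarith) ((hKL.2 s t hst).trans ?_)
      have h2 : ((t : ℝ) - s) ^ (2 * β) = (((t : ℝ) - s) ^ β) ^ 2 := by
        rw [mul_comm, Real.rpow_mul h0, Real.rpow_two]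
      rw [h2, mul_assoc, mul_assoc, ← mul_pow, ← mul_pow]
      exact mul_le_mul_of_nonneg_left
        (pow_le_pow_left₀ (mul_nonneg hxL.1 h0) (hLx _ h0 hsth) 2) hsew)
    (fun s t hst => by
      obtain ⟨i, j, p, q, hij, hjn, hp, hq, h1, h2, h3, h4, h5⟩ := exists_grid_points hT hn hst
      obtain ⟨g1, g2⟩ := hgrid i j hij hjn p q hp hq
      refine ⟨p, q, h1, h2, h3, h4, h5, g1, g2.trans ?_⟩
      -- The number of cells is `(q - p)/h`, so the accumulated error is `A h^(κ-1) (q - p)`; since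
      -- `2α ≤ 1`, the factor `q - p` is then bounded by a multiple of `(q - p)^(2α)`.
      have e1 : ((j : ℝ) - i) * (A * h ^ κ) = A * h ^ (κ - 1) * ((q : ℝ) - p) := by
        rw [hp, hq, ← hh, Real.rpow_sub hh0, Real.rpow_one]
        field_simp
      rw [e1]
      rcases h2.eq_or_lt with rfl | h2
      · simp [Real.zero_rpow (mul_pos two_pos hα).ne']
      have e2 := rpow_le_rpow_mul_rpow (coe_sub_pos h2) (coe_sub_le p q) hα2
      rw [Real.rpow_one] at e2
      have e3 : h ^ (κ - 1) ≤ h ^ η := Real.rpow_le_rpow_of_exponent_ge hh0 hh1 hη2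
      have e4 : 0 ≤ ((q : ℝ) - p) ^ (2 * α) := Real.rpow_nonneg (coe_sub_nonneg h2.le) _
      have e5 := coe_sub_nonneg h2.le
      calc _ ≤ A * h ^ η * (T ^ (1 - 2 * α) * ((q : ℝ) - p) ^ (2 * α)) := by gcongr
        _ = A * T ^ (1 - 2 * α) * (h ^ η * ((q : ℝ) - p) ^ (2 * α)) := by ring
        _ ≤ C * (h ^ η * ((q : ℝ) - p) ^ (2 * α)) :=
          mul_le_mul_of_nonneg_right (by linarith) (by positivity)
        _ = _ := by rw [he]; ring)
    hM
  refine ⟨x, areaOf x K, hxL.isBVLift hKL hα (by linarith), ?_⟩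
  have heC : e ≤ C := mul_le_of_le_one_right hC0 (Real.rpow_le_one hh0.le hh1 hη.le)
  have hfin : 4 * e + e * (5 + 4 * M + e) < r := by
    refine lt_of_le_of_lt ?_ (hsmall h hh0.le (hhmin.trans (min_le_left _ _)))
    calc 4 * e + e * (5 + 4 * M + e) = e * (9 + 4 * M + e) := by ring
      _ ≤ e * (9 + 4 * M + C) := by gcongr
      _ = _ := by rw [he]; ring
  calc roughDist α X (areaOf X J) x (areaOf x K)
      ≤ ENNReal.ofReal (4 * e) + ENNReal.ofReal (e * (5 + 4 * M + e)) :=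
        add_le_add (hoelder_le fun s t hst => (hclose s t hst).1)
          (hoelder_le fun s t hst => (hclose s t hst).2)
    _ = ENNReal.ofReal (4 * e + e * (5 + 4 * M + e)) :=
        (ENNReal.ofReal_add (by positivity) (by positivity)).symm
    _ < ENNReal.ofReal r := (ENNReal.ofReal_lt_ofReal_iff hr).2 hfin
    _ ≤ ε := hrε

/-- Rough integrals of controlled paths with values in a Banach space against weakly geometric
rough paths in `ℝ^m` are geometric rough paths. -/
theorem exists_geometric_integral [CompleteSpace E] (hT : 0 < T) {m : ℕ} {α β : ℝ}
    (hα : 1 < 3 * α) (hαβ : α < β) (hβ : 2 * β ≤ 1) {Z : I T → Rd m}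
    {ZZ : I T → I T → PT (Rd m)} (hZ : IsWeaklyGeometric β Z ZZ) {Y : I T → Fin m → E}
    {Y' : I T → Fin m → Fin m → E}
    (hY : ∀ i, IsControlled α Z (fun t => Y t i) fun t l => Y' t i l) :
    ∃ (X : I T → E) (XX : I T → I T → PT E),
      IsRoughIntegral Z ZZ Y Y' X XX ∧ IsGeometric α X XX := by
  have hα0 : 0 < α := by linarith
  set W : I T → I T → Fin m → Fin m → ℝ := fun s t l i => ptCoord l i (ZZ s t)
  have hZβ : IsRoughCoord β Z W := hZ.rough.isRoughCoord
  have hZα := hZβ.mono hαβ.le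
  have hYc := IsControlled.isControlledCoord hY
  obtain ⟨X, hX0, hX, hXsew⟩ := hZα.exists_integral hT.le hα hYc
  obtain ⟨J, -, hJ, hJsew⟩ := hZα.exists_integral hT.le hα (hYc.tmul_integral hα0 hZα hX)
  have harea := hYc.areaOf_expansion hα0 hZα hX hJ
  refine ⟨X, areaOf X J, ⟨hX0, fun s t _ => hXsew s t, fun s t _ => ?_⟩, ?_⟩
  · have h := hJsew s t
    rwa [show J t - J s = areaOf X J s t + tmul (X s) (X t - X s) by
      rw [areaOf, sub_add_cancel]] at h
  · have hanti := hYc.areaOf_antisymm hα0 hZα (fun s t hst l i => hZ.coord_add_coord hst l i)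
      hX harea
    -- A coefficient of order `2β` is split evenly between the two sides of a parallelogram, so that
    -- each has order `β`.
    have hsqrt : ∀ p : Fin m × Fin m, HBound β fun s t => √|W s t p.1 p.2 / 2| := fun p => by
      obtain ⟨C, hC, hW⟩ := hZβ.area p.1 p.2
      refine ⟨√C, Real.sqrt_nonneg C, fun s t hst => ?_⟩
      have h0 := coe_sub_pos hst
      rw [Real.norm_of_nonneg (Real.sqrt_nonneg _)]
      refine Real.sqrt_le_iff.2 ⟨by positivity, ?_⟩
      rw [mul_pow, Real.sq_sqrt hC, ← Real.rpow_two, ← Real.rpow_mul h0.le, mul_comm β, abs_div,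
        abs_two]
      have := hW s t hst
      rw [Real.norm_eq_abs] at this
      linarith [abs_nonneg (W s t p.1 p.2)]
    have hYb : ∀ i, HBound 0 fun s _ : I T => Y s i := fun i => by
      obtain ⟨A, hA⟩ := (hYc.incr_path hα0 hZα i).exists_norm_le hα0
      exact HBound.left hA
    -- The sign of the coefficient is put on the second side. The condition `2β ≤ 3α` holds because
    -- `2β ≤ 1 < 3α`.
    refine isGeometric_areaOf (ι := Fin m × Fin m) (β := β) (κ := 3 * α)
      (a := fun p s t => √|W s t p.1 p.2 / 2| • Y s p.1)
      (b := fun p s t => (SignType.sign (W s t p.1 p.2 / 2) * √|W s t p.1 p.2 / 2| : ℝ) • Y s p.2)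
      hT hα0 (by linarith) hαβ (by linarith) hα (fun p => ?_) (fun p => ?_)
      (hYc.integral_incr hα0 (by linarith) hZα hZβ hX)
      (hYc.areaOf_bound hα0 (by linarith) hZα hZβ harea) (hanti.congr fun s t _ => ?_)
    · have h := (hsqrt p).smul (hYb p.1)
      rwa [add_zero] at h
    · have hs : HBound β fun s t =>
          (SignType.sign (W s t p.1 p.2 / 2) * √|W s t p.1 p.2 / 2| : ℝ) := by
        have h := (HBound.left (T := T) (f := fun _ => (1 : ℝ)) fun _ => le_rfl).mul_bound
          (hsqrt p) (k := fun s t =>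
            (SignType.sign (W s t p.1 p.2 / 2) * √|W s t p.1 p.2 / 2| : ℝ)) fun s t => by
            rw [norm_mul]
            gcongr
            rcases lt_trichotomy (W s t p.1 p.2 / 2) 0 with h | h | h <;> simp [h]
        rwa [zero_add] at h
      have h := hs.smul (hYb p.2)
      rwa [add_zero] at h
    · congr 1
      rw [Fintype.sum_prod_type, Finset.sum_comm]
      refine Finset.sum_congr rfl fun i _ => Finset.sum_congr rfl fun l _ => ?_
      have hc : √|W s t l i / 2| * (SignType.sign (W s t l i / 2) * √|W s t l i / 2|)
          = W s t l i / 2 := by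
        rw [mul_left_comm, Real.mul_self_sqrt (abs_nonneg _), sign_mul_abs]
      simp only [smul_tmul, tmul_smul, smul_smul]
      rw [hc, mul_comm _ √|W s t l i / 2|, hc, smul_sub]

end Approximation

end RoughMV

end

theorem proposition6p3 (d m k : ℕ) (hk : (d : ℝ) / 2 < k) (T : ℝ) (hT : 0 < T)
    (αbar α ρ : ℝ) (hαbar : 1 / 3 < αbar ∧ αbar < 1 / 2) (hα : 1 / 3 < α ∧ α < αbar)
    (hρ : 1 ≤ ρ)
    (Z : I T → Rd m) (ZZ : I T → I T → PT (Rd m)) (hZ : IsWeaklyGeometric αbar Z ZZ)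
    (μ : MeasureTheory.Measure (C0Path α T d)) (γ : I T → Fin m → Rd d → Rd d)
    (hμ : IsControlledMeasure k ρ Z μ γ)
    (φ : Fin m → Rd d → Rd d → Rd d) (hφ : ∀ i, MemCb3Hk k (φ i)) :
    ∃ (X : I T → Hk d k) (XX : I T → I T → PT (Hk d k)),
      IsRoughIntegral Z ZZ (fun t i => toHk k (muPhi μ (φ i) t))
        (fun t i l => toHk k (muGrad μ (φ i) γ t l)) X XX ∧
      IsGeometric α X XX := by
  -- Here `E` is `H^k`; completeness is the instance derived from `isClosed_HkSub`, and the
  -- integrands are controlled by the definition of a controlled measure.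
  exact exists_geometric_integral hT (by linarith) hα.2 (by linarith) hZ
    fun i => hμ.controlled (φ i) (hφ i)
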